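/- Let $X$ be a flag, simply connected simplicial complex. A loop in $X$ is a subcomplex $\gamma$ that is a triangulated circle. A filling diagram for $\gamma$ is a simplicial map $f\colon D\to X$ from a triangulated $2$-disc $D$ (a finite simplicial complex) that maps $\partial D$ isomorphically onto $\gamma$; it is minimal if $D$ has the least number of triangles among all filling diagrams for $\gamma$. The complex $X$ is called $t$-uniform if, for every loop $\gamma$ in $X$ and every minimal filling diagram $(D,f)$ for $\gamma$, every interior vertex of $D$ has exactly $t$ neighbours in $D$. For an interior vertex $v$ of such a disc $D$ and $n\ge 0$, the sphere of radius $n$ centred at $v$ is the set of edges of $D$ both of whose endpoints are at distance $n$ from $v$ in the $1$-skeleton of $D$. Its length is the number of these edges, and its area is the number of triangles of $D$ inside it, i.e. of triangles all of whose vertices are at distance at most $n$ from $v$. The sphere is called full if it is not cut off by $\partial D$, i.e. if every vertex of $D$ at distance less than $n$ from $v$ is an interior vertex of $D$. **Theorem.** Let $t\ge 7$. There are sequences of natural numbers $(|S_n^t|)_{n\ge0}$ and $(A_n^t)_{n\ge0}$, depending only on $t$, such that for every $t$-uniform simplicial complex $X$, every loop $\gamma$ in $X$, every minimal filling diagram $(D,f)$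 for $\gamma$, every interior vertex $v$ of $D$ and every $n\ge0$ for which the sphere of radius $n$ centred at $v$ is full, this sphere has length $|S_n^t|$ and area $A_n^t$. Moreover, these sequences can be chosen so that the sequence $\left(A_n^t/|S_n^t|\right)_{n\ge 1}$ is strictly increasing, $$\lim_{n\to\infty}\frac{A_n^t}{|S_n^t|}=\sqrt{\frac{t-2}{t-6}},$$ and $$A_n^t<\sqrt{\frac{t-2}{t-6}}\cdot|S_n^t|\qquad\text{for all } n\ge1 .$$ In particular, for $t=7$, $A_n^7<\sqrt5\cdot|S_n^7|$ for all $n\ge 1$. -/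

import Mathlib

open Filter Topology

namespace AbstractSimplicialComplex

variable {V : Type*} {W : Type*}

/-- The `1`-skeleton: two distinct vertices are adjacent when they lie in a common face
(equivalently, since faces are closed under passing to subsets, when they span an edge). -/
def skeleton (K : AbstractSimplicialComplex V) : SimpleGraph V where
  Adj u v := u ≠ v ∧ ∃ s ∈ K, u ∈ s ∧ v ∈ s
  symm := ⟨fun _ _ ⟨h, s, hs, hu, hv⟩ => ⟨h.symm, s, hs, hv, hu⟩⟩
  loopless := ⟨fun _ h => h.1 rfl⟩

/-- A complex is flag if every nonempty finite set of pairwise adjacent vertices is a face. -/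
def IsFlag (K : AbstractSimplicialComplex V) : Prop :=
  ∀ s : Finset V, s.Nonempty →
    (∀ u ∈ s, ∀ v ∈ s, u ≠ v → K.skeleton.Adj u v) → s ∈ K

/-- Homotopy of edge paths relative to their endpoints, as in the edge-path group: the congruence
on walks in the `1`-skeleton that is generated by deleting a backtracking and by replacing two
consecutive sides of a triangle of the complex by the third side. -/
inductive EdgeHomotopic (K : AbstractSimplicialComplex V) :
    ∀ {u v : V}, K.skeleton.Walk u v → K.skeleton.Walk u v → Prop
  | refl {u v : V} (p : K.skeleton.Walk u v) : EdgeHomotopic K p p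
  | symm {u v : V} {p q : K.skeleton.Walk u v} :
      EdgeHomotopic K p q → EdgeHomotopic K q p
  | trans {u v : V} {p q r : K.skeleton.Walk u v} :
      EdgeHomotopic K p q → EdgeHomotopic K q r → EdgeHomotopic K p r
  | cons {u v w : V} (h : K.skeleton.Adj u v) {p q : K.skeleton.Walk v w} :
      EdgeHomotopic K p q → EdgeHomotopic K (.cons h p) (.cons h q)
  | backtrack {u v w : V} (h : K.skeleton.Adj u v) (h' : K.skeleton.Adj v u)
      (p : K.skeleton.Walk u w) : EdgeHomotopic K (.cons h (.cons h' p)) p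
  | triangle {u v w x : V} (huv : K.skeleton.Adj u v) (hvw : K.skeleton.Adj v w)
      (huw : K.skeleton.Adj u w) (hface : ∃ s ∈ K, u ∈ s ∧ v ∈ s ∧ w ∈ s)
      (p : K.skeleton.Walk w x) :
      EdgeHomotopic K (.cons huv (.cons hvw p)) (.cons huw p)

/-- A complex is simply connected if it is nonempty and connected and its edge-path group is
trivial. -/
def IsSimplyConnected (K : AbstractSimplicialComplex V) : Prop :=
  K.skeleton.Connected ∧ ∀ (u : V) (p : K.skeleton.Walk u u), K.EdgeHomotopic p .nil

/-- The triangles (`2`-simplices) of a complex. -/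
def triangles (K : AbstractSimplicialComplex V) : Set (Finset V) :=
  {s | s ∈ K ∧ s.card = 3}

/-- The number of triangles of a (finite) complex. -/
noncomputable def area (K : AbstractSimplicialComplex V) : ℕ :=
  K.triangles.ncard

/-- The triangles that contain a given edge. -/
def trianglesOn (K : AbstractSimplicialComplex V) (e : Sym2 V) : Set (Finset V) :=
  {s ∈ K.triangles | ∀ v ∈ e, v ∈ s}

/-- The `1`-skeleton of the link of a vertex `v`: its vertices are the neighbours of `v`, and two
of them are adjacent when they span a triangle together with `v`. -/
def linkGraph (K : AbstractSimplicialComplex V) (v : V) :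
    SimpleGraph {w : V // K.skeleton.Adj v w} where
  Adj a b := a ≠ b ∧ ∃ s ∈ K, v ∈ s ∧ a.1 ∈ s ∧ b.1 ∈ s
  symm := ⟨fun _ _ ⟨h, s, hs, hv, ha, hb⟩ => ⟨h.symm, s, hs, hv, hb, ha⟩⟩
  loopless := ⟨fun _ h => h.1 rfl⟩

/-- The boundary edges of a triangulated surface: the edges that lie in exactly one triangle. -/
def boundaryEdges (K : AbstractSimplicialComplex V) : Set (Sym2 V) :=
  {e ∈ K.skeleton.edgeSet | (K.trianglesOn e).ncard = 1}

/-- The vertices that lie on the boundary. -/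
def boundaryVertices (K : AbstractSimplicialComplex V) : Set V :=
  {v | ∃ e ∈ K.boundaryEdges, v ∈ e}

/-- The interior vertices: those that do not lie on the boundary. -/
def interiorVertices (K : AbstractSimplicialComplex V) : Set V :=
  (K.boundaryVertices)ᶜ

/-- A triangulated `2`-disc: a finite triangulated surface that is simply connected and has
nonempty boundary.  That the complex is a surface with boundary means that it has dimension at
most `2`, that every edge lies in one or two triangles, and that the link of every vertex is
nonempty and connected; the link is then a finite connected graph all of whose degrees are `1`
or `2`, that is, a path with at least one edge or a cycle.  By the classification of compact
surfaces the simply connected ones with nonempty boundary are exactly the closed discs. -/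
structure IsDisc [Finite W] (D : AbstractSimplicialComplex W) : Prop where
  card_le : ∀ s ∈ D, s.card ≤ 3
  edge : ∀ e ∈ D.skeleton.edgeSet, (D.trianglesOn e).ncard = 1 ∨ (D.trianglesOn e).ncard = 2
  link : ∀ v : W, (D.linkGraph v).Connected
  simplyConnected : D.IsSimplyConnected
  boundary_nonempty : D.boundaryEdges.Nonempty

/-- A map of vertices is simplicial if the image of every face is a face. -/
def IsSimplicialMap (D : AbstractSimplicialComplex W) (X : AbstractSimplicialComplex V)
    (f : W → V) : Prop :=
  ∀ s ∈ D, ∃ s' ∈ X, (s' : Set V) = f '' (s : Set W)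

/-- `(D, f)` is a filling diagram for the closed walk `γ` of `X` (used for `γ` a cycle): `D` is a
triangulated disc and `f : D → X` is a simplicial map whose restriction to the boundary of `D` is
an isomorphism onto `γ`. -/
structure IsFillingDiagram (X : AbstractSimplicialComplex V) {x : V} (γ : X.skeleton.Walk x x)
    [Finite W] (D : AbstractSimplicialComplex W) (f : W → V) : Prop where
  disc : D.IsDisc
  simplicial : IsSimplicialMap D X f
  injOn_boundary : Set.InjOn f D.boundaryVertices
  image_boundary : Sym2.map f '' D.boundaryEdges = {e | e ∈ γ.edges}

/-- A filling diagram is minimal if no filling diagram for the same loop has smaller area. Since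
discs are finite, it loses no generality to let their vertices form a type in `Type`. -/
def IsMinimalFillingDiagram (X : AbstractSimplicialComplex V) {x : V}
    (γ : X.skeleton.Walk x x) {W : Type} [Finite W] (D : AbstractSimplicialComplex W)
    (f : W → V) : Prop :=
  X.IsFillingDiagram γ D f ∧
    ∀ (W' : Type) [Finite W'] (D' : AbstractSimplicialComplex W') (f' : W' → V),
      X.IsFillingDiagram γ D' f' → D.area ≤ D'.area

/-- A `t`-uniform complex: a flag, simply connected complex such that, for every loop (embedded
cycle in the `1`-skeleton) and every minimal filling diagram `(D, f)` for it, every interior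
vertex of `D` has exactly `t` neighbours in `D`. -/
def IsUniform (X : AbstractSimplicialComplex V) (t : ℕ) : Prop :=
  X.IsFlag ∧ X.IsSimplyConnected ∧
    ∀ (x : V) (γ : X.skeleton.Walk x x), γ.IsCycle →
      ∀ (W : Type) [Finite W] (D : AbstractSimplicialComplex W) (f : W → V),
        X.IsMinimalFillingDiagram γ D f →
          ∀ v ∈ D.interiorVertices, (D.skeleton.neighborSet v).ncard = t

/-- The sphere of radius `n` centred at `v`: the set of edges spanned by the vertices at distance
`n` from `v` in the `1`-skeleton. -/
def sphere (D : AbstractSimplicialComplex W) (v : W) (n : ℕ) : Set (Sym2 W) :=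
  {e ∈ D.skeleton.edgeSet | ∀ w ∈ e, D.skeleton.dist v w = n}

/-- The length of a sphere: the number of its edges. -/
noncomputable def sphereLength (D : AbstractSimplicialComplex W) (v : W) (n : ℕ) : ℕ :=
  (D.sphere v n).ncard

/-- The area of a sphere: the number of triangles inside it, that is, of triangles all of whose
vertices are at distance at most `n` from the centre. -/
noncomputable def sphereArea (D : AbstractSimplicialComplex W) (v : W) (n : ℕ) : ℕ :=
  {s ∈ D.triangles | ∀ w ∈ s, D.skeleton.dist v w ≤ n}.ncard

/-- The sphere of radius `n` centred at `v` is not cut off by the boundary of `D`: every vertex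
that is closer to `v` than `n` is an interior vertex. (Vertices of the sphere itself may lie on
the boundary of `D`.) -/
def IsFullSphere (D : AbstractSimplicialComplex W) (v : W) (n : ℕ) : Prop :=
  ∀ w : W, D.skeleton.dist v w < n → w ∈ D.interiorVertices

end AbstractSimplicialComplex

/-! Put `q = t - 6`. Uniformity turns every minimal diagram into a disc whose interior vertices all
have degree `t ≥ 7`, and everything else takes place in that disc.

The geometric core is a convexity property of full spheres, `IsLayer`: the parents of a vertex (its
neighbours one step closer to the centre) span a triangle with it when there are two, and every edge
of the sphere spans a triangle with a parent. It is proved by induction on the radius with a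
combinatorial Gauss-Bonnet formula. The curvatures `curv` of a set of triangles sum to six times its
Euler characteristic (`sum_curv`); a vertex surrounded by triangles of the set has curvature `6 - t
< 0`, and a boundary vertex in `d` triangles has curvature at most `3 - d`. The ball has Euler
characteristic at most 1, since it is connected and carries no closed surface. The ball together
with everything enclosed by it and by the edges at one or two further vertices has Euler
characteristic at least 1, since its cycles bound inside it. Filling therefore cannot lower the
total curvature (`sum_curvDiff_nonneg`). If convexity failed at the next radius, filling would lower
it (`IsLayer.parents_adj_succ`, `IsLayer.exists_common_parent`). Homology is taken modulo two, so
boundaries are simply sets of edges.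

Given convexity, a full sphere of positive radius with interior vertices has as many vertices as
edges, and each triangle between consecutive spheres has exactly one edge on one of them. Counting
incidences gives `S (n + 1) + S (n - 1) = (t - 4) * S n` for `n ≥ 1` and `A (n + 1) = A n + S n + S
(n + 1)`, with `S 0 = 0`, `S 1 = t`, `A 0 = 0`. Hence `S n = t * u` and `A n = t * a` with `u =
(lucasPair q n).1`, `a = lucasArea q n`.

The recurrence preserves a quadratic form, which becomes `q a² + 4 a = (q + 4) u²`
(`lucasArea_quadratic`). So `a / u` is the square root of `(q + 4) / q * (1 - 4 / (q a + 4))`: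
monotonicity, limit and bound can all be read off, as `a` increases to infinity. -/

/-! ### The recurrence and the ratio of area to length -/

/-- The pair `(uₙ, uₙ₊₁ - uₙ)` for the sequence `u₀ = 0`, `u₁ = 1`, `uₙ₊₂ = (q + 2) uₙ₊₁ - uₙ`. -/
def lucasPair (q : ℕ) : ℕ → ℕ × ℕ
  | 0 => (0, 1)
  | n + 1 => ((lucasPair q n).1 + (lucasPair q n).2,
      (lucasPair q n).2 + q * ((lucasPair q n).1 + (lucasPair q n).2))

/-- The sum of `uₖ + uₖ₊₁` over `k < n`. -/
def lucasArea (q : ℕ) : ℕ → ℕ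
  | 0 => 0
  | n + 1 => lucasArea q n + (lucasPair q n).1 + (lucasPair q (n + 1)).1

theorem lucasPair_succ_fst (q n : ℕ) :
    (lucasPair q (n + 1)).1 = (lucasPair q n).1 + (lucasPair q n).2 := rfl

theorem lucasPair_succ_snd (q n : ℕ) :
    (lucasPair q (n + 1)).2 = (lucasPair q n).2 + q * (lucasPair q (n + 1)).1 := rfl

theorem lucasArea_succ (q n : ℕ) :
    lucasArea q (n + 1) = lucasArea q n + (lucasPair q n).1 + (lucasPair q (n + 1)).1 := rfl

theorem lucasPair_recurrence (q n : ℕ) :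
    (lucasPair q (n + 2)).1 + (lucasPair q n).1 = (q + 2) * (lucasPair q (n + 1)).1 := by
  rw [lucasPair_succ_fst q (n + 1), lucasPair_succ_snd, lucasPair_succ_fst]
  ring

theorem lucasPair_snd_pos (q n : ℕ) : 0 < (lucasPair q n).2 := by
  induction n with
  | zero => simp [lucasPair]
  | succ n ih => rw [lucasPair_succ_snd]; omega

theorem lucasPair_fst_pos (q : ℕ) {n : ℕ} (hn : 1 ≤ n) : 0 < (lucasPair q n).1 := by
  obtain ⟨m, rfl⟩ := Nat.exists_eq_add_of_le' hn
  have := lucasPair_snd_pos q m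
  rw [lucasPair_succ_fst]; omega

theorem lucasArea_strictMono (q : ℕ) : StrictMono (lucasArea q) := by
  refine strictMono_nat_of_lt_succ fun n => ?_
  have := lucasPair_fst_pos q (Nat.le_add_left 1 n)
  simp only [lucasArea]; omega

/-- The recurrence acts on pairs by a linear map that preserves this quadratic form, so its initial
value 1 persists. -/
theorem lucasPair_norm (q n : ℕ) :
    ((lucasPair q n).2 : ℝ) ^ 2 - q * (lucasPair q n).1 * (lucasPair q n).2
      - q * (lucasPair q n).1 ^ 2 = 1 := by
  induction n with
  | zero => simp [lucasPair]
  | succ n ih =>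
    rw [lucasPair_succ_snd, lucasPair_succ_fst]
    push_cast
    linear_combination ih

theorem lucasArea_linear (q n : ℕ) :
    (q : ℝ) * lucasArea q n + 2 + q * (lucasPair q n).1 = 2 * (lucasPair q n).2 := by
  induction n with
  | zero => simp [lucasPair, lucasArea]
  | succ n ih =>
    rw [lucasPair_succ_snd, lucasArea]
    push_cast
    linear_combination ih

/-- Eliminating the difference `uₙ₊₁ - uₙ` between the invariant form and the linear relation leaves
a relation between area and length alone. -/
theorem lucasArea_quadratic {q : ℕ} (hq : 0 < q) (n : ℕ) :
    (q : ℝ) * (lucasArea q n) ^ 2 + 4 * lucasArea q n = (q + 4) * (lucasPair q n).1 ^ 2 := by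
  have h1 := lucasPair_norm q n
  have h2 := lucasArea_linear q n
  have hq' : (q : ℝ) ≠ 0 := by positivity
  apply mul_left_cancel₀ hq'
  have h3 : (q : ℝ) * lucasArea q n = 2 * (lucasPair q n).2 - 2 - q * (lucasPair q n).1 := by
    linarith
  have : (q : ℝ) * (q * (lucasArea q n) ^ 2 + 4 * lucasArea q n) =
      (q * lucasArea q n) ^ 2 + 4 * (q * lucasArea q n) := by ring
  rw [this, h3]
  linear_combination 4 * h1

/-- The quadratic relation solved for the ratio. The right side depends on `n` only through the area
and increases with it, which yields monotonicity, limit and strict bound. -/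
theorem lucasArea_div_eq {q : ℕ} (hq : 0 < q) {n : ℕ} (hn : 1 ≤ n) :
    (lucasArea q n : ℝ) / (lucasPair q n).1 =
      Real.sqrt ((q + 4) / q * (1 - 4 / (q * lucasArea q n + 4))) := by
  have hu : (0 : ℝ) < (lucasPair q n).1 := by exact_mod_cast lucasPair_fst_pos q hn
  have hq' : (0 : ℝ) < q := by exact_mod_cast hq
  have ha : (0 : ℝ) ≤ lucasArea q n := by positivity
  symm
  rw [Real.sqrt_eq_iff_mul_self_eq_of_pos]
  · have h := lucasArea_quadratic hq n
    have h4 : (q : ℝ) * lucasArea q n + 4 ≠ 0 := by positivity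
    field_simp
    linear_combination (lucasArea q n : ℝ) * q * h
  · have : 0 < lucasArea q n := lucasArea_strictMono q (show 0 < n by omega)
    positivity

theorem strictMonoOn_lucasArea_div {q : ℕ} (hq : 0 < q) :
    StrictMonoOn (fun n : ℕ => (lucasArea q n : ℝ) / (lucasPair q n).1) (Set.Ici 1) := by
  intro m hm n hn hmn
  have hq' : (0 : ℝ) < q := by exact_mod_cast hq
  have hlt : (lucasArea q m : ℝ) < lucasArea q n := by
    exact_mod_cast lucasArea_strictMono q hmn
  simp only
  rw [lucasArea_div_eq hq hm, lucasArea_div_eq hq hn]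
  have h0 : (0 : ℝ) ≤ lucasArea q m := by positivity
  apply Real.sqrt_lt_sqrt
  · have : (4 : ℝ) / (q * lucasArea q m + 4) ≤ 1 := by
      rw [div_le_one (by positivity)]
      have : 0 ≤ (q : ℝ) * lucasArea q m := by positivity
      linarith
    have : 0 ≤ 1 - (4 : ℝ) / (q * lucasArea q m + 4) := by linarith
    positivity
  · gcongr

theorem tendsto_lucasArea_div {q : ℕ} (hq : 0 < q) :
    Tendsto (fun n : ℕ => (lucasArea q n : ℝ) / (lucasPair q n).1) atTop
      (𝓝 (Real.sqrt ((q + 4) / q))) := by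
  have hq' : (0 : ℝ) < q := by exact_mod_cast hq
  have h1 : Tendsto (fun n : ℕ => (q : ℝ) * lucasArea q n + 4) atTop atTop := by
    apply tendsto_atTop_add_const_right
    apply Tendsto.const_mul_atTop hq'
    exact tendsto_natCast_atTop_atTop.comp (lucasArea_strictMono q).tendsto_atTop
  have h2 : Tendsto (fun n : ℕ => (q + 4 : ℝ) / q * (1 - 4 / (q * lucasArea q n + 4))) atTop
      (𝓝 ((q + 4) / q * (1 - 0))) :=
    ((tendsto_const_nhds.sub (tendsto_const_nhds.div_atTop h1))).const_mul _
  rw [sub_zero, mul_one] at h2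
  refine ((Real.continuous_sqrt.tendsto _).comp h2).congr' ?_
  filter_upwards [eventually_ge_atTop 1] with n hn
  exact (lucasArea_div_eq hq hn).symm

theorem lucasArea_lt {q : ℕ} (hq : 0 < q) {n : ℕ} (hn : 1 ≤ n) :
    (lucasArea q n : ℝ) < Real.sqrt ((q + 4) / q) * (lucasPair q n).1 := by
  have hu : (0 : ℝ) < (lucasPair q n).1 := by exact_mod_cast lucasPair_fst_pos q hn
  have hq' : (0 : ℝ) < q := by exact_mod_cast hq
  have ha : 0 < lucasArea q n := lucasArea_strictMono q (show 0 < n by omega)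
  rw [← div_lt_iff₀ hu, lucasArea_div_eq hq hn]
  have h4 : (0 : ℝ) < 4 / (q * lucasArea q n + 4) := by positivity
  refine (Real.sqrt_lt_sqrt_iff_of_pos (by positivity)).2 ?_
  have : (0 : ℝ) < (q + 4) / q := by positivity
  nlinarith

/-! ### Degrees and curvature of a set of triangles -/

namespace TriangleSet

open scoped Classical
open Finset Finsupp

section Counting

variable {W : Type*}

/-- The number of triangles of `T` that contain both `x` and `y`. -/
noncomputable def codeg (T : Finset (Finset W)) (x y : W) : ℕ := #{s ∈ T | x ∈ s ∧ y ∈ s}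

/-- The number of triangles of `T` that contain `x`. -/
noncomputable def deg (T : Finset (Finset W)) (x : W) : ℕ := #{s ∈ T | x ∈ s}

variable {T U : Finset (Finset W)} {x y : W}

theorem codeg_comm (T : Finset (Finset W)) (x y : W) : codeg T x y = codeg T y x := by
  simp only [codeg, and_comm]

theorem codeg_pos : 0 < codeg T x y ↔ ∃ s ∈ T, x ∈ s ∧ y ∈ s := by
  simp [codeg, card_pos, Finset.Nonempty]

theorem codeg_mono (h : T ⊆ U) (x y : W) : codeg T x y ≤ codeg U x y :=
  card_le_card (filter_subset_filter _ h)

theorem deg_mono (h : T ⊆ U) (x : W) : deg T x ≤ deg U x :=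
  card_le_card (filter_subset_filter _ h)

theorem deg_lt_deg (h : T ⊆ U) {s : Finset W} (hs : s ∈ U) (hs' : s ∉ T) (hx : x ∈ s) :
    deg T x < deg U x := by
  refine card_lt_card ((ssubset_iff_of_subset (filter_subset_filter _ h)).2 ⟨s, ?_, ?_⟩)
  · simp [hs, hx]
  · simp [hs']

theorem codeg_add_of_disjoint (h : Disjoint T U) (x y : W) :
    codeg (T ∪ U) x y = codeg T x y + codeg U x y := by
  rw [codeg, filter_union, card_union_of_disjoint (disjoint_filter_filter h)]; rfl

theorem codeg_eq_of_forall (h : T ⊆ U) (hx : ∀ s ∈ U, x ∈ s → y ∈ s → s ∈ T) :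
    codeg T x y = codeg U x y := by
  refine le_antisymm (codeg_mono h x y) (card_le_card fun s hs => ?_)
  simp only [mem_filter] at hs ⊢
  exact ⟨hx s hs.1 hs.2.1 hs.2.2, hs.2⟩

theorem deg_eq_of_forall (h : T ⊆ U) (hx : ∀ s ∈ U, x ∈ s → s ∈ T) : deg T x = deg U x := by
  refine le_antisymm (deg_mono h x) (card_le_card fun s hs => ?_)
  simp only [mem_filter] at hs ⊢
  exact ⟨hx s hs.1 hs.2, hs.2⟩

variable [Fintype W]

/-- The vertices that share a triangle of `T` with `x`. -/
noncomputable def nbrs (T : Finset (Finset W)) (x : W) : Finset W :=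
  {y | y ≠ x ∧ ∃ s ∈ T, x ∈ s ∧ y ∈ s}

/-- The vertices of the triangles of `T`. -/
noncomputable def verts (T : Finset (Finset W)) : Finset W := {x | ∃ s ∈ T, x ∈ s}

/-- The edges of the triangles of `T`. -/
noncomputable def edges (T : Finset (Finset W)) : Finset (Sym2 W) :=
  {e | ¬ e.IsDiag ∧ ∃ s ∈ T, ∀ x ∈ e, x ∈ s}

theorem mem_nbrs : y ∈ nbrs T x ↔ y ≠ x ∧ ∃ s ∈ T, x ∈ s ∧ y ∈ s := by simp [nbrs]

theorem mem_verts : x ∈ verts T ↔ ∃ s ∈ T, x ∈ s := by simp [verts]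

theorem mk_mem_edges : s(x, y) ∈ edges T ↔ x ≠ y ∧ ∃ s ∈ T, x ∈ s ∧ y ∈ s := by
  simp [edges]

theorem mk_mem_edges_iff_nbrs : s(x, y) ∈ edges T ↔ y ∈ nbrs T x := by
  rw [mk_mem_edges, mem_nbrs, ne_comm]

theorem deg_pos : 0 < deg T x ↔ x ∈ verts T := by
  simp [deg, card_pos, Finset.Nonempty, mem_verts]

theorem nbrs_eq_of_forall (h : T ⊆ U) (hx : ∀ s ∈ U, x ∈ s → s ∈ T) : nbrs T x = nbrs U x := by
  ext y
  simp only [mem_nbrs]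
  constructor
  · rintro ⟨h1, s, h2, h3⟩; exact ⟨h1, s, h h2, h3⟩
  · rintro ⟨h1, s, h2, h3⟩; exact ⟨h1, s, hx s h2 h3.1, h3⟩

theorem sum_codeg (hT : ∀ s ∈ T, #s = 3) (x : W) :
    ∑ y ∈ nbrs T x, codeg T x y = 2 * deg T x := by
  have h1 : ∀ y ∈ nbrs T x, codeg T x y = #(bipartiteAbove (fun y s => y ∈ s)
      {s ∈ T | x ∈ s} y) := by
    intro y _
    simp only [bipartiteAbove, codeg, filter_filter]
  rw [sum_congr rfl h1, sum_card_bipartiteAbove_eq_sum_card_bipartiteBelow,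
    sum_const_nat (m := 2), mul_comm]; · rfl
  intro s hs
  simp only [mem_filter] at hs
  have : bipartiteBelow (fun y s => y ∈ s) (nbrs T x) s = s.erase x := by
    ext y
    simp only [bipartiteBelow, mem_filter, mem_nbrs, mem_erase]
    constructor
    · rintro ⟨⟨h1, -⟩, h2⟩; exact ⟨h1, h2⟩
    · rintro ⟨h1, h2⟩; exact ⟨⟨h1, s, hs.1, hs.2, h2⟩, h2⟩
  rw [this, card_erase_of_mem hs.2, hT s hs.1]

theorem deg_eq_card_nbrs (hT : ∀ s ∈ T, #s = 3) (hx : ∀ y ∈ nbrs T x, codeg T x y = 2) :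
    deg T x = #(nbrs T x) := by
  have h := sum_codeg hT x
  rw [sum_congr rfl hx, sum_const, smul_eq_mul] at h
  omega

/-- The curvature of `T` at `x`, scaled so that the total curvature is six times the Euler
characteristic. -/
noncomputable def curv (T : Finset (Finset W)) (x : W) : ℤ :=
  (if x ∈ verts T then 6 else 0) + 2 * deg T x - 3 * #(nbrs T x)

theorem sum_deg (hT : ∀ s ∈ T, #s = 3) : ∑ x, deg T x = 3 * #T := by
  have h : ∀ x ∈ (univ : Finset W), deg T x = #(bipartiteAbove (fun x s => x ∈ s) T x) :=
    fun x _ => rfl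
  rw [sum_congr rfl h, sum_card_bipartiteAbove_eq_sum_card_bipartiteBelow,
    sum_const_nat (m := 3), mul_comm]
  intro s hs
  simp [bipartiteBelow, hT s hs]

theorem sum_card_nbrs (T : Finset (Finset W)) : ∑ x, #(nbrs T x) = 2 * #(edges T) := by
  have h : ∀ x ∈ (univ : Finset W),
      #(nbrs T x) = #(bipartiteAbove (fun x e => x ∈ e) (edges T) x) := by
    intro x _
    refine card_bij (fun y _ => s(x, y)) ?_ ?_ ?_
    · intro y hy
      simp only [bipartiteAbove, mem_filter, mk_mem_edges_iff_nbrs]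
      exact ⟨hy, by simp⟩
    · intro y _ z _ h
      exact Sym2.congr_right.1 h
    · intro e he
      simp only [bipartiteAbove, mem_filter] at he
      obtain ⟨y, rfl⟩ := he.2
      exact ⟨y, mk_mem_edges_iff_nbrs.1 he.1, rfl⟩
  rw [sum_congr rfl h, sum_card_bipartiteAbove_eq_sum_card_bipartiteBelow,
    sum_const_nat (m := 2), mul_comm]
  intro e he
  induction e with | _ x y =>
  have hxy : x ≠ y := (mk_mem_edges.1 he).1
  have : bipartiteBelow (fun x e => x ∈ e) univ s(x, y) = {x, y} := by
    ext z; simp [bipartiteBelow]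
  rw [this, card_pair hxy]

/-- Combinatorial Gauss-Bonnet: each triangle is counted at three vertices and each edge at two, so
the weights 2 and 3 in `curv` both become 6. -/
theorem sum_curv (hT : ∀ s ∈ T, #s = 3) :
    ∑ x, curv T x = 6 * (#(verts T) - #(edges T) + #T : ℤ) := by
  have h1 := sum_deg hT
  have h2 := sum_card_nbrs T
  have h3 : ∑ x, (if x ∈ verts T then (6 : ℤ) else 0) = 6 * #(verts T) := by
    rw [← sum_filter, sum_const, filter_univ_mem]; simp [mul_comm]
  have h1' : ∑ x, (deg T x : ℤ) = 3 * #T := by exact_mod_cast h1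
  have h2' : ∑ x, (#(nbrs T x) : ℤ) = 2 * #(edges T) := by exact_mod_cast h2
  simp only [curv]
  rw [sum_sub_distrib, sum_add_distrib, ← Finset.mul_sum, ← Finset.mul_sum, h1', h2', h3]
  ring

end Counting

/-! ### Chains modulo two and bounds on the Euler characteristic -/

section Chains

variable {W : Type*}

/-- The boundary of `1`-chains modulo two. -/
noncomputable def bdOne (W : Type*) : (Sym2 W →₀ ZMod 2) →ₗ[ZMod 2] (W →₀ ZMod 2) :=
  Finsupp.linearCombination (ZMod 2)
    (Sym2.lift ⟨fun x y => single x 1 + single y 1, fun _ _ => add_comm _ _⟩)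

/-- The boundary of `2`-chains modulo two. -/
noncomputable def bdTwo (W : Type*) : (Finset W →₀ ZMod 2) →ₗ[ZMod 2] (Sym2 W →₀ ZMod 2) :=
  Finsupp.linearCombination (ZMod 2) (fun s => ∑ e ∈ s.sym2 with ¬ e.IsDiag, single e 1)

theorem bdOne_single (x y : W) :
    bdOne W (single s(x, y) 1) = single x 1 + single y 1 := by
  simp [bdOne]

theorem zmod_two_eq_one {a : ZMod 2} (h : a ≠ 0) : a = 1 := by
  revert h; revert a; decide

theorem chain_add_self {α : Type*} (c : α →₀ ZMod 2) : c + c = 0 := by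
  ext a; exact CharTwo.add_self_eq_zero _

/-- This links homology with counting: where edges lie in at most two triangles, the boundary of a
chain is the set of edges with `codeg` equal to 1 in its support. -/
theorem bdTwo_apply (f : Finset W →₀ ZMod 2) {x y : W} (h : x ≠ y) :
    bdTwo W f s(x, y) = (codeg f.support x y : ZMod 2) := by
  have h1 : ∀ s ∈ f.support, (f s • ∑ e ∈ s.sym2 with ¬ e.IsDiag, single e (1 : ZMod 2)) s(x, y)
      = if x ∈ s ∧ y ∈ s then 1 else 0 := by
    intro s hs
    rw [zmod_two_eq_one (Finsupp.mem_support_iff.1 hs), one_smul, Finsupp.finsetSum_apply]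
    simp only [single_apply, Finset.sum_ite_eq', mem_filter, mk_mem_sym2_iff, Sym2.mk_isDiag_iff,
      h, not_false_eq_true, and_true]
  rw [bdTwo, linearCombination_apply, Finsupp.sum, Finsupp.finsetSum_apply, sum_congr rfl h1,
    Finset.sum_boole]
  rfl

theorem bdTwo_apply_diag (f : Finset W →₀ ZMod 2) (x : W) : bdTwo W f s(x, x) = 0 := by
  rw [bdTwo, linearCombination_apply, Finsupp.sum, Finsupp.finsetSum_apply]
  refine Finset.sum_eq_zero fun s _ => ?_
  simp [single_apply]

theorem bdTwo_single {x y z : W} (hxy : x ≠ y) (hxz : x ≠ z) (hyz : y ≠ z) :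
    bdTwo W (single {x, y, z} 1) = single s(x, y) 1 + single s(x, z) 1 + single s(y, z) 1 := by
  have : ({e ∈ ({x, y, z} : Finset W).sym2 | ¬ e.IsDiag} : Finset (Sym2 W)) =
      {s(x, y), s(x, z), s(y, z)} := by
    ext e
    induction e with | _ a b =>
    simp only [mem_filter, mk_mem_sym2_iff, mem_insert, Finset.mem_singleton, Sym2.mk_isDiag_iff,
      Sym2.eq_iff]
    grind
  rw [bdTwo, linearCombination_single, one_smul, this, sum_insert, sum_insert, sum_singleton,
    add_assoc]
  all_goals simp only [mem_insert, Finset.mem_singleton, Sym2.eq_iff]; grind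

theorem bdOne_bdTwo {T : Finset (Finset W)} (hT : ∀ s ∈ T, #s = 3) {f : Finset W →₀ ZMod 2}
    (hf : f ∈ supported (ZMod 2) (ZMod 2) (T : Set (Finset W))) : bdOne W (bdTwo W f) = 0 := by
  rw [supported_eq_span_single] at hf
  have : Submodule.span (ZMod 2) ((fun i => single i (1 : ZMod 2)) '' (T : Set (Finset W))) ≤
      LinearMap.ker (bdOne W ∘ₗ bdTwo W) := by
    rw [Submodule.span_le]
    rintro _ ⟨s, hs, rfl⟩
    obtain ⟨x, y, z, hxy, hxz, hyz, rfl⟩ := card_eq_three.1 (hT s hs)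
    simp only [SetLike.mem_coe, LinearMap.mem_ker, LinearMap.comp_apply, bdTwo_single hxy hxz hyz,
      map_add, bdOne_single]
    have h2 := chain_add_self (single x (1 : ZMod 2))
    have h3 := chain_add_self (single y (1 : ZMod 2))
    have h4 := chain_add_self (single z (1 : ZMod 2))
    calc _ = (single x (1 : ZMod 2) + single x 1) + (single y 1 + single y 1)
        + (single z 1 + single z 1) := by abel
      _ = 0 := by rw [h2, h3, h4]; simp
  exact this hf

theorem finrank_supported {α : Type*} (s : Finset α) :
    Module.finrank (ZMod 2) (supported (ZMod 2) (ZMod 2) (s : Set α)) = #s := by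
  rw [(supportedEquivFinsupp (M := ZMod 2) (R := ZMod 2) (s : Set α)).finrank_eq,
    Module.finrank_finsupp_self]
  simp

instance finite_supported {α : Type*} (s : Finset α) :
    Module.Finite (ZMod 2) (supported (ZMod 2) (ZMod 2) (s : Set α)) :=
  Module.Finite.equiv (supportedEquivFinsupp (M := ZMod 2) (R := ZMod 2) (s : Set α)).symm

variable [Fintype W] {T : Finset (Finset W)}

theorem map_bdOne_le (T : Finset (Finset W)) :
    (supported (ZMod 2) (ZMod 2) (edges T : Set (Sym2 W))).map (bdOne W) ≤
      supported (ZMod 2) (ZMod 2) (verts T : Set W) := by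
  rw [supported_eq_span_single, Submodule.map_span, Submodule.span_le]
  rintro _ ⟨_, ⟨e, he, rfl⟩, rfl⟩
  induction e with | _ x y =>
  obtain ⟨-, s, hs, hx, hy⟩ := mk_mem_edges.1 (mem_coe.1 he)
  simp only [bdOne_single]
  exact add_mem (single_mem_supported _ _ (mem_verts.2 ⟨s, hs, hx⟩))
    (single_mem_supported _ _ (mem_verts.2 ⟨s, hs, hy⟩))

theorem map_bdTwo_le (T : Finset (Finset W)) :
    (supported (ZMod 2) (ZMod 2) (T : Set (Finset W))).map (bdTwo W) ≤
      supported (ZMod 2) (ZMod 2) (edges T : Set (Sym2 W)) := by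
  rintro _ ⟨f, hf, rfl⟩
  rw [mem_supported']
  intro e he
  induction e with | _ x y =>
  by_cases hxy : x = y
  · subst hxy; exact bdTwo_apply_diag f x
  rw [bdTwo_apply f hxy]
  have hf' : (f.support : Finset (Finset W)) ⊆ T := by
    simpa using (mem_supported _ f).1 hf
  have : codeg f.support x y = 0 := by
    by_contra h
    obtain ⟨s, hs, h⟩ := codeg_pos.1 (Nat.pos_of_ne_zero h)
    exact he (mem_coe.2 (mk_mem_edges.2 ⟨hxy, s, hf' hs, h⟩))
  simp [this]

/-- The Euler characteristic is at least one if every cycle bounds. -/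
theorem card_edges_lt (hne : (verts T).Nonempty)
    (H : ∀ c ∈ supported (ZMod 2) (ZMod 2) (edges T : Set (Sym2 W)), bdOne W c = 0 →
      ∃ f ∈ supported (ZMod 2) (ZMod 2) (T : Set (Finset W)), bdTwo W f = c) :
    #(edges T) < #(verts T) + #T := by
  set E := supported (ZMod 2) (ZMod 2) (edges T : Set (Sym2 W))
  set F := supported (ZMod 2) (ZMod 2) (T : Set (Finset W))
  set V := supported (ZMod 2) (ZMod 2) (verts T : Set W)
  have hrk := LinearMap.finrank_range_add_finrank_ker (K := ZMod 2) (V := E) (V₂ := W →₀ ZMod 2)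
    ((bdOne W).domRestrict E)
  rw [finrank_supported] at hrk
  -- All cycles bound, so the cycle space lies in the image of the span of `T`.
  have hker : Module.finrank (ZMod 2) (LinearMap.ker ((bdOne W).domRestrict E)) ≤ #T := by
    have h1 : (LinearMap.ker ((bdOne W).domRestrict E)).map E.subtype ≤ F.map (bdTwo W) := by
      rintro _ ⟨c, hc, rfl⟩
      obtain ⟨f, hf, h⟩ := H c.1 c.2 (by simpa using hc)
      exact ⟨f, hf, h⟩
    have h2 := Submodule.finrank_mono h1
    rw [LinearEquiv.finrank_eq (Submodule.equivMapOfInjective E.subtype E.injective_subtype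
      (LinearMap.ker ((bdOne W).domRestrict E))).symm] at h2
    have h3 := Submodule.finrank_map_le (bdTwo W) F
    rw [finrank_supported] at h3
    exact h2.trans h3
  have hrange : Module.finrank (ZMod 2) (LinearMap.range ((bdOne W).domRestrict E)) < #(verts T) := by
    rw [← finrank_supported]
    apply Submodule.finrank_lt_finrank_of_lt
    rw [LinearMap.range_domRestrict]
    obtain ⟨x, hx⟩ := hne
    refine lt_of_le_of_ne (map_bdOne_le T) fun heq => ?_
    have hx' : single x (1 : ZMod 2) ∈ E.map (bdOne W) := by
      rw [heq]; exact single_mem_supported _ _ hx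
    -- Boundaries of edges have even augmentation and a single vertex has odd augmentation, so the
    -- image of `bdOne` is a proper subspace.
    have haug : E.map (bdOne W) ≤
        LinearMap.ker (Finsupp.linearCombination (ZMod 2) (fun _ : W => (1 : ZMod 2))) := by
      rw [show E = _ from supported_eq_span_single _ _, Submodule.map_span, Submodule.span_le]
      rintro _ ⟨_, ⟨e, -, rfl⟩, rfl⟩
      induction e with | _ x y =>
      simp only [bdOne_single, SetLike.mem_coe, LinearMap.mem_ker, map_add,
        linearCombination_single]
      decide
    have := haug hx'
    simp at this
  omega

/-- The Euler characteristic is at most one if there are no `2`-cycles and every vertex is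
connected to `v`. -/
theorem card_verts_add_card_le (hT : ∀ s ∈ T, #s = 3)
    (hinj : ∀ f ∈ supported (ZMod 2) (ZMod 2) (T : Set (Finset W)), bdTwo W f = 0 → f = 0) (v : W)
    (H : ∀ x ∈ verts T, single x (1 : ZMod 2) ∈
      (supported (ZMod 2) (ZMod 2) (edges T : Set (Sym2 W))).map (bdOne W) ⊔
        Submodule.span (ZMod 2) {single v (1 : ZMod 2)}) :
    #(verts T) + #T ≤ #(edges T) + 1 := by
  set E := supported (ZMod 2) (ZMod 2) (edges T : Set (Sym2 W))
  set F := supported (ZMod 2) (ZMod 2) (T : Set (Finset W))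
  set V := supported (ZMod 2) (ZMod 2) (verts T : Set W)
  have hrk := LinearMap.finrank_range_add_finrank_ker (K := ZMod 2) (V := E) (V₂ := W →₀ ZMod 2)
    ((bdOne W).domRestrict E)
  rw [finrank_supported] at hrk
  -- Without 2-cycles, `bdTwo` embeds the span of `T` into the cycle space.
  have hker : #T ≤ Module.finrank (ZMod 2) (LinearMap.ker ((bdOne W).domRestrict E)) := by
    have h1 : F.map (bdTwo W) ≤ (LinearMap.ker ((bdOne W).domRestrict E)).map E.subtype := by
      rintro c ⟨f, hf, rfl⟩
      exact ⟨⟨bdTwo W f, map_bdTwo_le T ⟨f, hf, rfl⟩⟩, by simpa using bdOne_bdTwo hT hf, rfl⟩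
    have h2 := Submodule.finrank_mono h1
    rw [LinearEquiv.finrank_eq (Submodule.equivMapOfInjective E.subtype E.injective_subtype
      (LinearMap.ker ((bdOne W).domRestrict E))).symm] at h2
    rw [← LinearMap.range_domRestrict, LinearMap.finrank_range_of_inj, finrank_supported] at h2
    · exact h2
    · refine (injective_iff_map_eq_zero _).2 fun f hf => ?_
      exact Subtype.ext (hinj f.1 f.2 (by simpa using hf))
  have hrange : #(verts T) ≤
      Module.finrank (ZMod 2) (LinearMap.range ((bdOne W).domRestrict E)) + 1 := by
    rw [← finrank_supported, LinearMap.range_domRestrict]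
    have h1 : V ≤ E.map (bdOne W) ⊔ Submodule.span (ZMod 2) {single v (1 : ZMod 2)} := by
      rw [show V = _ from supported_eq_span_single _ _, Submodule.span_le]
      rintro _ ⟨x, hx, rfl⟩
      exact H x hx
    have h2 : Module.finrank (ZMod 2) V ≤ _ := Submodule.finrank_mono h1
    change Module.finrank (ZMod 2) V ≤ _
    have h3 := Submodule.finrank_add_le_finrank_add_finrank (E.map (bdOne W))
      (Submodule.span (ZMod 2) {single v (1 : ZMod 2)})
    have h4 := finrank_span_singleton (K := ZMod 2) (v := single v (1 : ZMod 2)) (by simp)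
    omega
  omega

end Chains

end TriangleSet

/-! ### Triangles named by their vertices -/

namespace TriangleSet

open scoped Classical
open Finset Finsupp

section Triples

variable {W : Type*} {T : Finset (Finset W)} {x y z : W}

theorem ne_of_triple_mem (hT : ∀ s ∈ T, #s = 3) (h : {x, y, z} ∈ T) :
    x ≠ y ∧ x ≠ z ∧ y ≠ z := by
  have := hT _ h
  refine ⟨?_, ?_, ?_⟩ <;> rintro rfl
  · simp only [insert_eq_of_mem (mem_insert_self _ _)] at this
    have := card_le_two (a := x) (b := z); omega
  · rw [insert_eq_of_mem (by simp)] at this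
    have := card_le_two (a := y) (b := x); omega
  · rw [insert_eq_of_mem (mem_singleton_self y)] at this
    have := card_le_two (a := x) (b := y); omega

theorem triple_rotate (h : {x, y, z} ∈ T) : {y, z, x} ∈ T := by
  have : ({y, z, x} : Finset W) = {x, y, z} := by ext; simp; tauto
  rwa [this]

theorem triple_swap (h : {x, y, z} ∈ T) : {x, z, y} ∈ T := by
  rwa [pair_comm z y]

theorem eq_triple {s : Finset W} (hs : #s = 3) (hx : x ∈ s) (hy : y ∈ s) (hz : z ∈ s)
    (hxy : x ≠ y) (hxz : x ≠ z) (hyz : y ≠ z) : s = {x, y, z} := by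
  symm
  apply eq_of_subset_of_card_le
  · intro w; simp only [mem_insert, Finset.mem_singleton]; rintro (rfl | rfl | rfl) <;> assumption
  · rw [hs, card_eq_three.2 ⟨x, y, z, hxy, hxz, hyz, rfl⟩]

theorem exists_eq_triple {s : Finset W} (hs : #s = 3) (hx : x ∈ s) (hy : y ∈ s)
    (hxy : x ≠ y) : ∃ z, x ≠ z ∧ y ≠ z ∧ s = {x, y, z} := by
  have h : 0 < #((s.erase x).erase y) := by
    rw [card_erase_of_mem (mem_erase.2 ⟨hxy.symm, hy⟩), card_erase_of_mem hx, hs]; norm_num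
  obtain ⟨z, hz⟩ := card_pos.1 h
  simp only [mem_erase] at hz
  exact ⟨z, hz.2.1.symm, hz.1.symm, eq_triple hs hx hy hz.2.2 hxy hz.2.1.symm hz.1.symm⟩

theorem triple_inj {w : W} (hyw : y ≠ w) (hxw : x ≠ w) (h : ({x, y, z} : Finset W) = {x, y, w}) :
    z = w := by
  have : w ∈ ({x, y, z} : Finset W) := by rw [h]; simp
  simp only [mem_insert, Finset.mem_singleton] at this
  tauto

theorem exists_two_of_codeg_eq_two (hT : ∀ s ∈ T, #s = 3) (hxy : x ≠ y) (h : codeg T x y = 2) :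
    ∃ a b, a ≠ b ∧ {x, y, a} ∈ T ∧ {x, y, b} ∈ T ∧ ∀ c, {x, y, c} ∈ T → c = a ∨ c = b := by
  obtain ⟨s, s', hne, hs⟩ := card_eq_two.1 h
  have h1 : s ∈ ({s, s'} : Finset (Finset W)) := by simp
  have h2 : s' ∈ ({s, s'} : Finset (Finset W)) := by simp
  rw [← hs] at h1 h2
  simp only [mem_filter] at h1 h2
  obtain ⟨a, -, -, rfl⟩ := exists_eq_triple (hT s h1.1) h1.2.1 h1.2.2 hxy
  obtain ⟨b, -, -, rfl⟩ := exists_eq_triple (hT s' h2.1) h2.2.1 h2.2.2 hxy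
  refine ⟨a, b, fun h => hne (by rw [h]), h1.1, h2.1, fun c hc => ?_⟩
  have h3 : ({x, y, c} : Finset W) ∈ ({{x, y, a}, {x, y, b}} : Finset (Finset W)) := by
    rw [← hs]; simp [hc]
  have ha := ne_of_triple_mem hT h1.1
  have hb := ne_of_triple_mem hT h2.1
  simp only [mem_insert, Finset.mem_singleton] at h3
  rcases h3 with h3 | h3
  · exact Or.inl (triple_inj ha.2.2 ha.2.1 h3)
  · exact Or.inr (triple_inj hb.2.2 hb.2.1 h3)

theorem two_le_codeg {a b : W} (hab : a ≠ b) (hxb : x ≠ b) (hyb : y ≠ b) (ha : {x, y, a} ∈ T)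
    (hb : {x, y, b} ∈ T) : 2 ≤ codeg T x y := by
  have h : #{({x, y, a} : Finset W), {x, y, b}} = 2 :=
    card_pair fun h => hab (triple_inj hyb hxb h)
  rw [← h]
  apply card_le_card
  intro s
  simp only [mem_insert, Finset.mem_singleton, mem_filter]
  rintro (rfl | rfl)
  · simp [ha]
  · simp [hb]

theorem exists_triple_ne_of_two_le_codeg (hT : ∀ s ∈ T, #s = 3) (hxy : x ≠ y)
    (h : 2 ≤ codeg T x y) (a : W) : ∃ b, b ≠ a ∧ {x, y, b} ∈ T := by
  obtain ⟨s, hs, s', hs', hne⟩ := one_lt_card.1 h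
  simp only [mem_filter] at hs hs'
  obtain ⟨b, -, -, rfl⟩ := exists_eq_triple (hT s hs.1) hs.2.1 hs.2.2 hxy
  obtain ⟨c, -, -, rfl⟩ := exists_eq_triple (hT s' hs'.1) hs'.2.1 hs'.2.2 hxy
  by_cases hb : b = a
  · exact ⟨c, fun hc => hne (by rw [hb, hc]), hs'.1⟩
  · exact ⟨b, hb, hs.1⟩

variable [Fintype W]

theorem mem_nbrs_of_triple (hT : ∀ s ∈ T, #s = 3) (h : {x, y, z} ∈ T) : y ∈ nbrs T x :=
  mem_nbrs.2 ⟨(ne_of_triple_mem hT h).1.symm, _, h, by simp, by simp⟩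

theorem mem_nbrs_comm : y ∈ nbrs T x ↔ x ∈ nbrs T y := by
  simp only [mem_nbrs, ne_comm, and_comm]

theorem nbrs_mono {U : Finset (Finset W)} (h : T ⊆ U) (x : W) : nbrs T x ⊆ nbrs U x := by
  intro y
  simp only [mem_nbrs]
  rintro ⟨h1, s, h2, h3⟩
  exact ⟨h1, s, h h2, h3⟩

theorem verts_mono {U : Finset (Finset W)} (h : T ⊆ U) : verts T ⊆ verts U := by
  intro y
  simp only [mem_verts]
  rintro ⟨s, h2, h3⟩
  exact ⟨s, h h2, h3⟩

/-- The number of boundary edges at a vertex is even. -/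
theorem card_boundary_nbrs (hT : ∀ s ∈ T, #s = 3) (h2 : ∀ x y, x ≠ y → codeg T x y ≤ 2) (x : W) :
    #{y ∈ nbrs T x | codeg T x y = 1} + 2 * deg T x = 2 * #(nbrs T x) := by
  rw [← sum_codeg hT x, card_filter, ← sum_add_distrib, mul_comm, ← smul_eq_mul, ← sum_const]
  refine sum_congr rfl fun y hy => ?_
  have h3 := h2 x y (mem_nbrs.1 hy).1.symm
  have h4 := codeg_pos.2 (mem_nbrs.1 hy).2
  split_ifs <;> omega

theorem exists_other_boundary (hT : ∀ s ∈ T, #s = 3) (h2 : ∀ x y, x ≠ y → codeg T x y ≤ 2)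
    (hxy : x ≠ y) (h : codeg T x y = 1) : ∃ z, z ≠ x ∧ z ≠ y ∧ codeg T x z = 1 := by
  have h3 := card_boundary_nbrs hT h2 x
  have hy : y ∈ ({y ∈ nbrs T x | codeg T x y = 1} : Finset W) :=
    mem_filter.2 ⟨mem_nbrs.2 ⟨hxy.symm, codeg_pos.1 (by omega)⟩, h⟩
  have h4 := card_pos.2 ⟨y, hy⟩
  obtain ⟨z, hz, hzy⟩ := exists_mem_ne (s := {y ∈ nbrs T x | codeg T x y = 1}) (by omega) y
  simp only [mem_filter, mem_nbrs] at hz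
  exact ⟨z, hz.1.1, hzy, hz.2⟩

theorem sum_univ_le_sum {f : W → ℤ} (S : Finset W) (h : ∀ x, x ∉ S → f x ≤ 0) :
    ∑ x, f x ≤ ∑ x ∈ S, f x := by
  rw [← Finset.sum_add_sum_compl S f]
  have : ∑ x ∈ Sᶜ, f x ≤ 0 := Finset.sum_nonpos fun x hx => h x (mem_compl.1 hx)
  linarith

end Triples

/-! ### Discs of constant interior degree: regions, Gauss-Bonnet, links -/

/-- The set of triangles of a triangulated disc whose interior vertices all have degree `t`, with
`7 ≤ t`. -/
structure IsRegularDisc {W : Type*} [Fintype W] (K : Finset (Finset W)) (t : ℕ) : Prop where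
  card_eq : ∀ s ∈ K, #s = 3
  codeg_le : ∀ x y, x ≠ y → codeg K x y ≤ 2
  link : ∀ (x : W) (P : W → Prop), (∃ y ∈ nbrs K x, P y) →
    (∀ y z, {x, y, z} ∈ K → P y → P z) → ∀ y ∈ nbrs K x, P y
  connected : ∀ P : W → Prop, (∃ x, P x) → (∀ x y, y ∈ nbrs K x → P x → P y) → ∀ x, P x
  boundary : ∃ x y, x ≠ y ∧ codeg K x y = 1
  cycle : ∀ c ∈ supported (ZMod 2) (ZMod 2) (edges K : Set (Sym2 W)), bdOne W c = 0 →
    ∃ f ∈ supported (ZMod 2) (ZMod 2) (K : Set (Finset W)), bdTwo W f = c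
  card_nbrs : ∀ x, (∀ y ∈ nbrs K x, codeg K x y = 2) → #(nbrs K x) = t
  le_degree : 7 ≤ t

/-- The union of all sets of triangles of `K` whose boundary edges satisfy `M`. -/
noncomputable def fill {W : Type*} (K : Finset (Finset W)) (M : W → W → Prop) :
    Finset (Finset W) :=
  {s ∈ K | ∃ Z ⊆ K, s ∈ Z ∧ ∀ x y, x ≠ y → codeg Z x y = 1 → M x y}

section Fill

variable {W : Type*} {K : Finset (Finset W)} {M : W → W → Prop}

theorem fill_subset : fill K M ⊆ K := filter_subset _ _

theorem subset_fill {Z : Finset (Finset W)} (hZ : Z ⊆ K)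
    (h : ∀ x y, x ≠ y → codeg Z x y = 1 → M x y) : Z ⊆ fill K M :=
  fun _ hs => mem_filter.2 ⟨hZ hs, Z, hZ, hs, h⟩

/-- A boundary edge of the union lies in a triangle of some admissible set, and is then a boundary
edge of that set. So the union is itself admissible, hence the largest admissible set. -/
theorem of_codeg_fill_eq_one {x y : W} (hxy : x ≠ y) (h : codeg (fill K M) x y = 1) : M x y := by
  obtain ⟨s, hs, hx, hy⟩ := codeg_pos.1 (h.symm ▸ one_pos)
  obtain ⟨-, Z, hZ, hsZ, hM⟩ := mem_filter.1 hs
  refine hM x y hxy (le_antisymm ?_ (codeg_pos.2 ⟨s, hsZ, hx, hy⟩))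
  rw [← h]
  exact codeg_mono (subset_fill hZ hM) x y

end Fill

namespace IsRegularDisc

variable {W : Type*} [Fintype W] {K : Finset (Finset W)} {t : ℕ}

theorem card_eq_of_subset (hK : IsRegularDisc K t) {T : Finset (Finset W)} (hT : T ⊆ K) :
    ∀ s ∈ T, #s = 3 := fun s hs => hK.card_eq s (hT hs)

theorem codeg_le_of_subset (hK : IsRegularDisc K t) {T : Finset (Finset W)} (hT : T ⊆ K) :
    ∀ x y, x ≠ y → codeg T x y ≤ 2 :=
  fun x y h => (codeg_mono hT x y).trans (hK.codeg_le x y h)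

/-- A set of triangles without boundary edges at `x` contains all triangles at `x`. -/
theorem mem_of_forall_codeg_ne_one (hK : IsRegularDisc K t) {T : Finset (Finset W)} (hT : T ⊆ K)
    {x : W} (hx : x ∈ verts T) (hb : ∀ y, y ≠ x → codeg T x y ≠ 1) {s : Finset W} (hs : s ∈ K)
    (hxs : x ∈ s) : s ∈ T := by
  have h2 : ∀ y ∈ nbrs T x, codeg T x y = 2 := by
    intro y hy
    have h3 := hK.codeg_le_of_subset hT x y (mem_nbrs.1 hy).1.symm
    have h4 := codeg_pos.2 (mem_nbrs.1 hy).2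
    have h5 := hb y (mem_nbrs.1 hy).1
    omega
  -- An edge already in two triangles of `T` has no room for another triangle of `K`.
  have hmem : ∀ y ∈ nbrs T x, ∀ s ∈ K, x ∈ s → y ∈ s → s ∈ T := by
    intro y hy s hs hxs hys
    by_contra hsT
    have hlt : codeg T x y < codeg K x y := by
      refine card_lt_card ((ssubset_iff_of_subset (filter_subset_filter _ hT)).2 ⟨s, ?_, ?_⟩)
      · simp [hs, hxs, hys]
      · simp [hsT]
    have := hK.codeg_le x y (mem_nbrs.1 hy).1.symm
    have := h2 y hy
    omega
  -- Connectedness of the link carries this saturation around `x`.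
  have hall : ∀ y ∈ nbrs K x, y ∈ nbrs T x := by
    apply hK.link x (fun y => y ∈ nbrs T x)
    · obtain ⟨r, hr, hxr⟩ := mem_verts.1 hx
      have : 0 < #(r.erase x) := by rw [card_erase_of_mem hxr, hK.card_eq r (hT hr)]; norm_num
      obtain ⟨y, hy⟩ := card_pos.1 this
      have hy' : y ∈ nbrs T x := mem_nbrs.2 ⟨(mem_erase.1 hy).1, r, hr, hxr, (mem_erase.1 hy).2⟩
      exact ⟨y, nbrs_mono hT x hy', hy'⟩
    · intro y z hyz hy
      have h := hmem y hy _ hyz (by simp) (by simp)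
      exact mem_nbrs_of_triple (hK.card_eq_of_subset hT) (triple_swap h)
  have : 0 < #(s.erase x) := by rw [card_erase_of_mem hxs, hK.card_eq s hs]; norm_num
  obtain ⟨y, hy⟩ := card_pos.1 this
  have hy' := (mem_erase.1 hy)
  exact hmem y (hall y (mem_nbrs.2 ⟨hy'.1, s, hs, hxs, hy'.2⟩)) s hs hxs hy'.2

theorem deg_eq_of_interior (hK : IsRegularDisc K t) {x : W}
    (hx : ∀ y ∈ nbrs K x, codeg K x y = 2) : deg K x = t := by
  rw [deg_eq_card_nbrs hK.card_eq hx, hK.card_nbrs x hx]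

theorem deg_eq_of_forall_codeg_ne_one (hK : IsRegularDisc K t) {T : Finset (Finset W)}
    (hT : T ⊆ K) {x : W} (hx : x ∈ verts T) (hb : ∀ y, y ≠ x → codeg T x y ≠ 1) :
    deg T x = t ∧ #(nbrs T x) = t := by
  have h := fun s => hK.mem_of_forall_codeg_ne_one hT hx hb (s := s)
  rw [deg_eq_of_forall hT h, nbrs_eq_of_forall hT h]
  have hint : ∀ y ∈ nbrs K x, codeg K x y = 2 := by
    intro y hy
    have hyx := (mem_nbrs.1 hy).1
    have h1 := hb y hyx
    rw [codeg_eq_of_forall hT fun s hs hxs _ => h s hs hxs] at h1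
    have h3 := hK.codeg_le x y hyx.symm
    have h4 := codeg_pos.2 (mem_nbrs.1 hy).2
    omega
  exact ⟨hK.deg_eq_of_interior hint, hK.card_nbrs x hint⟩

/-- There are no nonempty sets of triangles without boundary. -/
theorem eq_empty_of_forall_codeg_ne_one (hK : IsRegularDisc K t) {T : Finset (Finset W)}
    (hT : T ⊆ K) (hb : ∀ x y, x ≠ y → codeg T x y ≠ 1) : T = ∅ := by
  by_contra hne
  obtain ⟨s, hs⟩ := nonempty_iff_ne_empty.2 hne
  obtain ⟨x₀, hx₀⟩ := card_pos.1 (show 0 < #s by rw [hK.card_eq s (hT hs)]; norm_num)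
  -- Saturation spreads through the connected complex, so `T` would be all of `K`, which does have a
  -- boundary edge.
  have hall : ∀ x, x ∈ verts T := by
    apply hK.connected (fun x => x ∈ verts T) ⟨x₀, mem_verts.2 ⟨s, hs, hx₀⟩⟩
    intro x y hxy hx
    obtain ⟨-, r, hr, hxr, hyr⟩ := mem_nbrs.1 hxy
    exact mem_verts.2 ⟨r, hK.mem_of_forall_codeg_ne_one hT hx
      (fun y hy => hb x y hy.symm) hr hxr, hyr⟩
  obtain ⟨x, y, hxy, h⟩ := hK.boundary
  refine hb x y hxy ?_
  rw [codeg_eq_of_forall hT, h]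
  exact fun r hr hxr _ => hK.mem_of_forall_codeg_ne_one hT (hall x)
    (fun y hy => hb x y hy.symm) hr hxr

/-- A region that no disjoint region can be glued to along part of its boundary has Euler
characteristic at least one. -/
theorem six_le_sum_curv (hK : IsRegularDisc K t) {U : Finset (Finset W)} (hU : U ⊆ K)
    (hne : U.Nonempty) (hfill : ∀ R ⊆ K, Disjoint R U →
      (∀ x y, x ≠ y → codeg R x y = 1 → codeg U x y = 1) → R = ∅) : 6 ≤ ∑ x, curv U x := by
  rw [sum_curv (hK.card_eq_of_subset hU)]
  have hv : (verts U).Nonempty := by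
    obtain ⟨s, hs⟩ := hne
    obtain ⟨x, hx⟩ := card_pos.1 (show 0 < #s by rw [hK.card_eq s (hU hs)]; norm_num)
    exact ⟨x, mem_verts.2 ⟨s, hs, hx⟩⟩
  have hEU : edges U ⊆ edges K := by
    intro e
    induction e with | _ x y =>
    simp only [mk_mem_edges]
    rintro ⟨h1, s, h2, h3⟩
    exact ⟨h1, s, hU h2, h3⟩
  have := card_edges_lt hv fun c hc hc0 => by
    obtain ⟨f, hf, hfc⟩ := hK.cycle c (supported_mono (by exact_mod_cast hEU) hc) hc0
    refine ⟨f, ?_, hfc⟩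
    have hfK : f.support ⊆ K := by simpa using (mem_supported _ f).1 hf
    -- The part of the bounding chain outside `U` can have boundary only along edges of `U`:
    -- elsewhere `c` vanishes. Such an edge then lies in exactly one triangle of `U`, so this part
    -- is a disjoint region glued to the boundary of `U`.
    have hR : f.support \ U = ∅ := by
      refine hfill _ (sdiff_subset.trans hfK) sdiff_disjoint fun x y hxy h1 => ?_
      have hle := hK.codeg_le x y hxy
      have hdis := codeg_add_of_disjoint (sdiff_disjoint : Disjoint (f.support \ U) U) x y
      have hmono := codeg_mono (union_subset (sdiff_subset.trans hfK) hU :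
        (f.support \ U) ∪ U ⊆ K) x y
      by_contra hU1
      have hU0 : codeg U x y = 0 := by omega
      have hc' : c s(x, y) = 0 := by
        refine (mem_supported' _ c).1 hc _ fun hmem => ?_
        have := codeg_pos.2 (mk_mem_edges.1 (mem_coe.1 hmem)).2
        omega
      rw [← hfc, bdTwo_apply f hxy] at hc'
      have hd2 := codeg_add_of_disjoint (T := f.support \ U) (U := f.support ∩ U)
        (sdiff_disjoint.mono_right inter_subset_right) x y
      rw [sdiff_union_inter] at hd2
      have h0 : codeg (f.support ∩ U) x y ≤ codeg U x y := codeg_mono inter_subset_right x y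
      rw [show codeg f.support x y = 1 by omega] at hc'
      exact absurd hc' (by decide)
    rw [mem_supported]
    exact_mod_cast sdiff_eq_empty_iff_subset.1 hR
  have h' : (#(edges U) : ℤ) + 1 ≤ #(verts U) + #U := by exact_mod_cast this
  linarith

theorem curv_eq_zero {T : Finset (Finset W)} {x : W} (hx : x ∉ verts T) : curv T x = 0 := by
  have h1 : deg T x = 0 := by
    by_contra h; exact hx (deg_pos.1 (Nat.pos_of_ne_zero h))
  have h2 : nbrs T x = ∅ := by
    by_contra h
    obtain ⟨y, hy⟩ := nonempty_iff_ne_empty.2 h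
    obtain ⟨-, s, hs, hxs, -⟩ := mem_nbrs.1 hy
    exact hx (mem_verts.2 ⟨s, hs, hxs⟩)
  simp [curv, hx, h1, h2]

theorem curv_eq_of_forall_codeg_ne_one (hK : IsRegularDisc K t) {T : Finset (Finset W)}
    (hT : T ⊆ K) {x : W} (hx : x ∈ verts T) (hb : ∀ y, y ≠ x → codeg T x y ≠ 1) :
    curv T x = 6 - t := by
  obtain ⟨h1, h2⟩ := hK.deg_eq_of_forall_codeg_ne_one hT hx hb
  rw [curv, if_pos hx, h1, h2]; ring

theorem curv_nonpos_of_forall_codeg_ne_one (hK : IsRegularDisc K t) {T : Finset (Finset W)}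
    (hT : T ⊆ K) {x : W} (hb : ∀ y, y ≠ x → codeg T x y ≠ 1) : curv T x ≤ 0 := by
  by_cases hx : x ∈ verts T
  · rw [hK.curv_eq_of_forall_codeg_ne_one hT hx hb]
    have := hK.le_degree
    omega
  · rw [curv_eq_zero hx]

/-- The number of boundary edges at a vertex is even, so it is at least 2 here. Hence there are at
least `deg + 1` neighbours, and the bound is `6 + 2 * deg - 3 * (deg + 1)`. -/
theorem curv_le_of_codeg_eq_one (hK : IsRegularDisc K t) {T : Finset (Finset W)}
    (hT : T ⊆ K) {x y : W} (hxy : x ≠ y) (h : codeg T x y = 1) : curv T x ≤ 3 - deg T x := by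
  have hb := card_boundary_nbrs (hK.card_eq_of_subset hT) (hK.codeg_le_of_subset hT) x
  have hy : y ∈ ({y ∈ nbrs T x | codeg T x y = 1} : Finset W) :=
    mem_filter.2 ⟨mem_nbrs.2 ⟨hxy.symm, codeg_pos.1 (by omega)⟩, h⟩
  have h4 := card_pos.2 ⟨y, hy⟩
  rw [curv]
  split_ifs <;> omega

theorem exists_support (hK : IsRegularDisc K t) {c : Sym2 W →₀ ZMod 2}
    (hc : c ∈ supported (ZMod 2) (ZMod 2) (edges K : Set (Sym2 W))) (hc0 : bdOne W c = 0) :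
    ∃ T ⊆ K, ∀ x y, x ≠ y → (codeg T x y = 1 ↔ c s(x, y) ≠ 0) := by
  obtain ⟨f, hf, rfl⟩ := hK.cycle c hc hc0
  have hfK : f.support ⊆ K := by simpa using (mem_supported _ f).1 hf
  refine ⟨f.support, hfK, fun x y hxy => ?_⟩
  rw [bdTwo_apply f hxy]
  have := hK.codeg_le_of_subset hfK x y hxy
  interval_cases codeg f.support x y <;> decide

theorem exists_boundary_eq_cycle (hK : IsRegularDisc K t) {x y z : W} (hxy : y ∈ nbrs K x)
    (hxz : z ∈ nbrs K x) (hyz : z ∈ nbrs K y) : ∃ T ⊆ K, ∀ a b, a ≠ b → (codeg T a b = 1 ↔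
      s(a, b) = s(x, y) ∨ s(a, b) = s(x, z) ∨ s(a, b) = s(y, z)) := by
  have nxy := (mem_nbrs.1 hxy).1.symm
  have nxz := (mem_nbrs.1 hxz).1.symm
  have nyz := (mem_nbrs.1 hyz).1.symm
  obtain ⟨T, hT, hcT⟩ := hK.exists_support
    (c := single s(x, y) 1 + single s(x, z) 1 + single s(y, z) 1)
    (add_mem (add_mem (single_mem_supported _ _ (mk_mem_edges_iff_nbrs.2 hxy))
    (single_mem_supported _ _ (mk_mem_edges_iff_nbrs.2 hxz)))
    (single_mem_supported _ _ (mk_mem_edges_iff_nbrs.2 hyz))) (by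
    simp only [map_add, bdOne_single]
    have h2 := chain_add_self (single x (1 : ZMod 2))
    have h3 := chain_add_self (single y (1 : ZMod 2))
    have h4 := chain_add_self (single z (1 : ZMod 2))
    calc _ = (single x (1 : ZMod 2) + single x 1) + (single y 1 + single y 1)
        + (single z 1 + single z 1) := by abel
      _ = 0 := by rw [h2, h3, h4]; simp)
  refine ⟨T, hT, fun a b hab => ?_⟩
  have d1 : s(x, y) ≠ s(x, z) := by simp; grind
  have d2 : s(x, y) ≠ s(y, z) := by simp; grind
  have d3 : s(x, z) ≠ s(y, z) := by simp; grind
  rw [hcT a b hab]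
  simp only [Finsupp.add_apply, single_apply]
  by_cases h1 : s(x, y) = s(a, b)
  · rw [← h1]; simp [d1, d2, d1.symm, d2.symm]
  by_cases h2 : s(x, z) = s(a, b)
  · rw [← h2]; simp [d1, d3, d1.symm, d3.symm]
  by_cases h3 : s(y, z) = s(a, b)
  · rw [← h3]; simp [d2, d3, d2.symm, d3.symm]
  simp [h1, h2, h3, Ne.symm h1, Ne.symm h2, Ne.symm h3]

/-- By parity at each vertex, the boundary of `R` is either the whole 3-cycle or empty. In the first
case `R ∪ T` has no boundary, in the second `R` has none; both force emptiness. -/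
theorem eq_empty_of_boundary_eq_cycle (hK : IsRegularDisc K t) {x y z : W} (nxy : x ≠ y)
    (nxz : x ≠ z) (nyz : y ≠ z) {T : Finset (Finset W)} (hT : T ⊆ K)
    (hbd : ∀ a b, a ≠ b → (codeg T a b = 1 ↔
      s(a, b) = s(x, y) ∨ s(a, b) = s(x, z) ∨ s(a, b) = s(y, z)))
    {R : Finset (Finset W)} (hR : R ⊆ K) (hdis : Disjoint R T)
    (hRT : ∀ x y, x ≠ y → codeg R x y = 1 → codeg T x y = 1) : R = ∅ := by
  have hR3 := hK.card_eq_of_subset hR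
  have hR2 := hK.codeg_le_of_subset hR
  have step : ∀ a b c, a ≠ b → (∀ d, d ≠ a → codeg T a d = 1 → d = b ∨ d = c) →
      codeg R a b = 1 → codeg R a c = 1 := by
    intro a b c hab hT' h
    obtain ⟨d, hda, hdb, hd⟩ := exists_other_boundary hR3 hR2 hab h
    rcases hT' d hda (hRT a d hda.symm hd) with rfl | rfl
    · exact absurd rfl hdb
    · exact hd
  have bx : ∀ d, d ≠ x → codeg T x d = 1 → d = y ∨ d = z := by
    intro d hd h
    have := (hbd x d hd.symm).1 h
    simp only [Sym2.eq_iff] at this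
    grind
  have by' : ∀ d, d ≠ y → codeg T y d = 1 → d = x ∨ d = z := by
    intro d hd h
    have := (hbd y d hd.symm).1 h
    simp only [Sym2.eq_iff] at this
    grind
  have bz : ∀ d, d ≠ z → codeg T z d = 1 → d = x ∨ d = y := by
    intro d hd h
    have := (hbd z d hd.symm).1 h
    simp only [Sym2.eq_iff] at this
    grind
  have xy_xz := step x y z nxy bx
  have xz_xy := step x z y nxz (fun d hd h => (bx d hd h).symm)
  have yx_yz := step y x z nxy.symm by'
  have yz_yx := step y z x nyz (fun d hd h => (by' d hd h).symm)
  rw [codeg_comm R y x] at yx_yz yz_yx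
  have hiff : ∀ a b, a ≠ b → codeg R a b = 1 → codeg R x y = 1 := by
    intro a b hab h
    have := (hbd a b hab).1 (hRT a b hab h)
    simp only [Sym2.eq_iff] at this
    rcases this with (⟨rfl, rfl⟩ | ⟨rfl, rfl⟩) | (⟨rfl, rfl⟩ | ⟨rfl, rfl⟩) |
      (⟨rfl, rfl⟩ | ⟨rfl, rfl⟩)
    · exact h
    · rwa [codeg_comm]
    · exact xz_xy h
    · rw [codeg_comm] at h; exact xz_xy h
    · exact yz_yx h
    · rw [codeg_comm] at h; exact yz_yx h
  by_cases hRxy : codeg R x y = 1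
  · have hempty := hK.eq_empty_of_forall_codeg_ne_one (union_subset hR hT) (by
      intro a b hab h
      rw [codeg_add_of_disjoint hdis] at h
      have hTab : codeg R a b = 1 ↔ codeg T a b = 1 := by
        refine ⟨hRT a b hab, fun h' => ?_⟩
        have := (hbd a b hab).1 h'
        simp only [Sym2.eq_iff] at this
        rcases this with (⟨rfl, rfl⟩ | ⟨rfl, rfl⟩) | (⟨rfl, rfl⟩ | ⟨rfl, rfl⟩) |
          (⟨rfl, rfl⟩ | ⟨rfl, rfl⟩)
        · exact hRxy
        · rwa [codeg_comm]
        · exact xy_xz hRxy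
        · rw [codeg_comm]; exact xy_xz hRxy
        · exact yx_yz hRxy
        · rw [codeg_comm]; exact yx_yz hRxy
      omega)
    exact (union_eq_empty.1 hempty).1
  · exact hK.eq_empty_of_forall_codeg_ne_one hR fun a b hab h => hRxy (hiff a b hab h)

/-- Three pairwise adjacent vertices span a triangle. -/
theorem triple_mem (hK : IsRegularDisc K t) {x y z : W} (hxy : y ∈ nbrs K x) (hxz : z ∈ nbrs K x)
    (hyz : z ∈ nbrs K y) : {x, y, z} ∈ K := by
  have nxy := (mem_nbrs.1 hxy).1.symm
  have nxz := (mem_nbrs.1 hxz).1.symm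
  have nyz := (mem_nbrs.1 hyz).1.symm
  obtain ⟨T, hT, hbd⟩ := hK.exists_boundary_eq_cycle hxy hxz hyz
  have cxy := (hbd x y nxy).2 (by simp)
  have cxz := (hbd x z nxz).2 (by simp)
  have cyz := (hbd y z nyz).2 (by simp)
  have hsum := hK.six_le_sum_curv hT
    (by obtain ⟨s, hs, -⟩ := codeg_pos.1 (cxy.symm ▸ one_pos); exact ⟨s, hs⟩) fun R hR hdis hRT =>
      hK.eq_empty_of_boundary_eq_cycle nxy nxz nyz hT hbd hR hdis hRT
  have hother : ∑ w, curv T w ≤ ∑ w ∈ {x, y, z}, curv T w := by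
    refine sum_univ_le_sum _ fun w hw => ?_
    refine hK.curv_nonpos_of_forall_codeg_ne_one hT fun d hd h => ?_
    have := (hbd w d hd.symm).1 h
    simp only [mem_insert, Finset.mem_singleton, not_or] at hw
    simp [hw.1, hw.2.1, hw.2.2] at this
  rw [sum_insert (by simp [nxy, nxz]), sum_insert (by simp [nyz]), sum_singleton] at hother
  -- The corners contribute at most 9 minus the sum of their degrees, and the total is at least 6.
  -- Each corner thus lies in exactly one triangle of the region, and the three corners share it.
  have h1 := hK.curv_le_of_codeg_eq_one hT nxy cxy
  have h2 := hK.curv_le_of_codeg_eq_one hT nxy.symm (by rwa [codeg_comm])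
  have h3 := hK.curv_le_of_codeg_eq_one hT nxz.symm (by rwa [codeg_comm])
  obtain ⟨s, hs, hsx, hsy⟩ := codeg_pos.1 (cxy.symm ▸ one_pos)
  obtain ⟨r, hr, hrx, hrz⟩ := codeg_pos.1 (cxz.symm ▸ one_pos)
  have p1 := deg_pos.2 (mem_verts.2 ⟨s, hs, hsx⟩)
  have p2 := deg_pos.2 (mem_verts.2 ⟨s, hs, hsy⟩)
  have p3 := deg_pos.2 (mem_verts.2 ⟨r, hr, hrz⟩)
  have hsr : s = r := card_le_one.1 (show deg T x ≤ 1 by omega) s (by simp [hs, hsx]) r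
    (by simp [hr, hrx])
  subst hsr
  rw [← eq_triple (hK.card_eq s (hT hs)) hsx hsy hrz nxy nxz nyz]
  exact hT hs

/-- A cycle in the link of a vertex has length at least `t`. -/
theorem le_card_of_link_cycle (hK : IsRegularDisc K t) {x : W} {P : Finset W} (hne : P.Nonempty)
    (hP : ∀ a ∈ P, ∃ b ∈ P, ∃ c ∈ P, b ≠ c ∧ {x, a, b} ∈ K ∧ {x, a, c} ∈ K) : t ≤ #P := by
  have h2 : ∀ a ∈ P, codeg K x a = 2 := by
    intro a ha
    obtain ⟨b, -, c, -, hbc, h1, h2⟩ := hP a ha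
    obtain ⟨n1, n2, n3⟩ := ne_of_triple_mem hK.card_eq h2
    exact le_antisymm (hK.codeg_le x a n1) (two_le_codeg hbc n2 n3 h1 h2)
  -- Both triangles on `xa` already lead to vertices of `P`, so the connected link never leaves `P`.
  -- The edges at `x` then all lie in two triangles, which makes `x` interior with `t` neighbours.
  have hall : ∀ a ∈ nbrs K x, a ∈ P := by
    apply hK.link x (fun a => a ∈ P)
    · obtain ⟨a, ha⟩ := hne
      obtain ⟨b, -, c, -, -, h1, -⟩ := hP a ha
      exact ⟨a, mem_nbrs_of_triple hK.card_eq h1, ha⟩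
    · intro a d had ha
      obtain ⟨b, hb, c, hc, hbc, h1, h3⟩ := hP a ha
      obtain ⟨n1, -, -⟩ := ne_of_triple_mem hK.card_eq h1
      obtain ⟨u, w, -, -, -, huw⟩ := exists_two_of_codeg_eq_two hK.card_eq n1 (h2 a ha)
      have e1 := huw b h1
      have e2 := huw c h3
      have e3 := huw d had
      grind
  rw [← hK.card_nbrs x fun a ha => h2 a (hall a ha)]
  exact card_le_card hall

theorem not_link_triangle (hK : IsRegularDisc K t) {x a b c : W} (hab : {x, a, b} ∈ K)
    (hbc : {x, b, c} ∈ K) (hca : {x, c, a} ∈ K) : False := by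
  have := hK.le_card_of_link_cycle (x := x) (P := {a, b, c}) (by simp) (by
    have n1 := (ne_of_triple_mem hK.card_eq hab).2.2
    have n2 := (ne_of_triple_mem hK.card_eq hbc).2.2
    have n3 := (ne_of_triple_mem hK.card_eq hca).2.2
    intro d hd
    simp only [mem_insert, Finset.mem_singleton] at hd
    rcases hd with rfl | rfl | rfl
    · exact ⟨b, by simp, c, by simp, n2, hab, triple_swap hca⟩
    · exact ⟨c, by simp, a, by simp, n3, hbc, triple_swap hab⟩
    · exact ⟨a, by simp, b, by simp, n1, hca, triple_swap hbc⟩)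
  have h3 := card_le_three (a := a) (b := b) (c := c)
  have := hK.le_degree
  omega

theorem not_link_square (hK : IsRegularDisc K t) {x a b c d : W} (hab : {x, a, b} ∈ K)
    (hbc : {x, b, c} ∈ K) (hcd : {x, c, d} ∈ K) (hda : {x, d, a} ∈ K) (hac : a ≠ c)
    (hbd : b ≠ d) : False := by
  have := hK.le_card_of_link_cycle (x := x) (P := {a, b, c, d}) (by simp) (by
    intro e he
    simp only [mem_insert, Finset.mem_singleton] at he
    rcases he with rfl | rfl | rfl | rfl
    · exact ⟨b, by simp, d, by simp, hbd, hab, triple_swap hda⟩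
    · exact ⟨c, by simp, a, by simp, hac.symm, hbc, triple_swap hab⟩
    · exact ⟨d, by simp, b, by simp, hbd.symm, hcd, triple_swap hbc⟩
    · exact ⟨a, by simp, c, by simp, hac, hda, triple_swap hcd⟩)
  have h3 := card_le_four (a := a) (b := b) (c := c) (d := d)
  have := hK.le_degree
  omega

end IsRegularDisc

end TriangleSet

/-! ### Balls, and spheres with the convexity property -/

namespace TriangleSet

open scoped Classical
open Finset Finsupp

variable {W : Type*} [Fintype W]

/-- The function `ρ` is the distance from `v` in the graph formed by the edges of `K`. -/
structure IsRadius (K : Finset (Finset W)) (v : W) (ρ : W → ℕ) : Prop where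
  eq_zero_iff : ∀ x, ρ x = 0 ↔ x = v
  le_succ : ∀ x, ∀ y ∈ nbrs K x, ρ y ≤ ρ x + 1
  exists_parent : ∀ x, x ≠ v → ∃ y ∈ nbrs K x, ρ y + 1 = ρ x

/-- The triangles all of whose vertices have radius at most `n`. -/
noncomputable def ball (K : Finset (Finset W)) (ρ : W → ℕ) (n : ℕ) : Finset (Finset W) :=
  {s ∈ K | ∀ x ∈ s, ρ x ≤ n}

/-- The neighbours of `x` that are closer to the centre. -/
noncomputable def parents (K : Finset (Finset W)) (ρ : W → ℕ) (x : W) : Finset W :=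
  {y ∈ nbrs K x | ρ y + 1 = ρ x}

/-- The neighbours of `x` on the same sphere. -/
noncomputable def siblings (K : Finset (Finset W)) (ρ : W → ℕ) (x : W) : Finset W :=
  {y ∈ nbrs K x | ρ y = ρ x}

/-- All edges at `x` lie in two triangles. -/
def IsInterior (K : Finset (Finset W)) (x : W) : Prop := ∀ y ∈ nbrs K x, codeg K x y = 2

/-- The convexity property of the sphere of radius `n`: the parents of a vertex span a simplex
with it, and so does some parent with an edge. -/
structure IsLayer (K : Finset (Finset W)) (ρ : W → ℕ) (n : ℕ) : Prop where
  parents_adj : ∀ x, ρ x = n → ∀ p ∈ parents K ρ x, ∀ q ∈ parents K ρ x, p ≠ q → {x, p, q} ∈ K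
  apex : ∀ x, ρ x = n → ∀ y ∈ siblings K ρ x, ∃ p ∈ parents K ρ x, {x, y, p} ∈ K

variable {K : Finset (Finset W)} {t : ℕ} {v : W} {ρ : W → ℕ} {n : ℕ}

theorem ball_subset : ball K ρ n ⊆ K := filter_subset _ _

theorem mem_parents {x y : W} : y ∈ parents K ρ x ↔ y ∈ nbrs K x ∧ ρ y + 1 = ρ x := by
  simp [parents]

theorem mem_siblings {x y : W} : y ∈ siblings K ρ x ↔ y ∈ nbrs K x ∧ ρ y = ρ x := by
  simp [siblings]

theorem triple_mem_ball {x y z : W} :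
    {x, y, z} ∈ ball K ρ n ↔ {x, y, z} ∈ K ∧ ρ x ≤ n ∧ ρ y ≤ n ∧ ρ z ≤ n := by
  simp [ball]

namespace IsRadius

theorem mem_ball_of_mem (hρ : IsRadius K v ρ) {x : W} (hx : ρ x < n) {s : Finset W} (hs : s ∈ K)
    (hxs : x ∈ s) : s ∈ ball K ρ n := by
  refine mem_filter.2 ⟨hs, fun y hy => ?_⟩
  by_cases hyx : y = x
  · subst hyx; omega
  · have := hρ.le_succ x y (mem_nbrs.2 ⟨hyx, s, hs, hxs, hy⟩)
    omega

theorem parents_nonempty (hρ : IsRadius K v ρ) {x : W} (hx : ρ x ≠ 0) :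
    (parents K ρ x).Nonempty := by
  obtain ⟨y, hy, h⟩ := hρ.exists_parent x (fun h => hx ((hρ.eq_zero_iff x).2 h))
  exact ⟨y, mem_parents.2 ⟨hy, h⟩⟩

theorem parents_or_siblings (hρ : IsRadius K v ρ) {x y : W} (hy : y ∈ nbrs K x) (h : ρ y ≤ ρ x) :
    y ∈ parents K ρ x ∨ y ∈ siblings K ρ x := by
  have := hρ.le_succ y x (mem_nbrs_comm.1 hy)
  simp only [mem_parents, mem_siblings, hy, true_and]
  omega

/-- Every vertex of a ball is joined to the centre by a chain inside the ball. -/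
theorem exists_chain (hρ : IsRadius K v ρ) (m : ℕ) :
    m ≤ n → ∀ x, ρ x = m →
      ∃ g ∈ supported (ZMod 2) (ZMod 2) (edges (ball K ρ n) : Set (Sym2 W)),
        bdOne W g = single x 1 + single v 1 := by
  induction m with
  | zero =>
    intro _ x hx
    rw [(hρ.eq_zero_iff x).1 hx]
    exact ⟨0, zero_mem _, by rw [map_zero, chain_add_self]⟩
  | succ m ih =>
    intro hm x hx
    obtain ⟨p, hp⟩ := hρ.parents_nonempty (x := x) (by omega)
    rw [mem_parents] at hp
    obtain ⟨g, hg, hgb⟩ := ih (by omega) p (by omega)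
    refine ⟨g + single s(x, p) 1, add_mem hg (single_mem_supported _ _ ?_), ?_⟩
    · obtain ⟨h1, s, hs, hxs, hps⟩ := mem_nbrs.1 hp.1
      exact mem_coe.2 (mk_mem_edges.2
        ⟨h1.symm, s, hρ.mem_ball_of_mem (x := p) (by omega) hs hps, hxs, hps⟩)
    · rw [map_add, hgb, bdOne_single]
      have := chain_add_self (single p (1 : ZMod 2))
      calc _ = (single p (1 : ZMod 2) + single p 1) + (single x 1 + single v 1) := by abel
        _ = _ := by rw [this, zero_add]

/-- Balls are connected through geodesics to `v` and contain no closed surface, so their Euler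
characteristic is at most 1. -/
theorem sum_curv_ball_le (hρ : IsRadius K v ρ) (hK : IsRegularDisc K t) (n : ℕ) :
    ∑ x, curv (ball K ρ n) x ≤ 6 := by
  rw [sum_curv (hK.card_eq_of_subset ball_subset)]
  have := card_verts_add_card_le (T := ball K ρ n) (hK.card_eq_of_subset ball_subset) (by
    intro f hf h0
    have hfK : f.support ⊆ K := (by simpa using (mem_supported _ f).1 hf : f.support ⊆ _).trans
      ball_subset
    rw [← Finsupp.support_eq_empty]
    refine hK.eq_empty_of_forall_codeg_ne_one hfK fun x y hxy h => ?_
    have := bdTwo_apply f hxy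
    rw [h0, h] at this
    exact absurd this (by simp)) v (by
    intro x hx
    obtain ⟨s, hs, hxs⟩ := mem_verts.1 hx
    obtain ⟨g, hg, hgb⟩ := hρ.exists_chain (n := n) (ρ x) ((mem_filter.1 hs).2 x hxs) x rfl
    rw [show single x (1 : ZMod 2) = bdOne W g + single v 1 by
      rw [hgb, add_assoc, chain_add_self, add_zero]]
    exact Submodule.add_mem_sup ⟨g, hg, rfl⟩ (Submodule.mem_span_singleton_self _))
  have h' : (#(verts (ball K ρ n)) : ℤ) + #(ball K ρ n) ≤ #(edges (ball K ρ n)) + 1 := by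
    exact_mod_cast this
  linarith

end IsRadius

namespace IsLayer

/-- Three parents, pairwise joined in the link of `x`, would form a link cycle of length 3, shorter
than `t`. -/
theorem card_parents_le (hL : IsLayer K ρ n) (hK : IsRegularDisc K t) {x : W} (hx : ρ x = n) :
    #(parents K ρ x) ≤ 2 := by
  by_contra! h
  obtain ⟨a, b, c, ha, hb, hc, hab, hac, hbc⟩ := two_lt_card_iff.1 h
  exact hK.not_link_triangle (hL.parents_adj x hx a ha b hb hab)
    (hL.parents_adj x hx b hb c hc hbc) (hL.parents_adj x hx c hc a ha hac.symm)

theorem apex_mem_ball (hL : IsLayer K ρ n) {x y : W} (hx : ρ x = n) (hy : y ∈ siblings K ρ x) :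
    ∃ p ∈ parents K ρ x, {x, y, p} ∈ ball K ρ n := by
  obtain ⟨p, hp, h⟩ := hL.apex x hx y hy
  rw [mem_siblings] at hy
  have := (mem_parents.1 hp).2
  exact ⟨p, hp, triple_mem_ball.2 ⟨h, by omega, by omega, by omega⟩⟩

/-- An edge of the sphere lies in exactly one triangle of the ball. -/
theorem codeg_ball_sibling (hL : IsLayer K ρ n) (hK : IsRegularDisc K t) (hρ : IsRadius K v ρ)
    {x y : W} (hx : ρ x = n) (hy : y ∈ siblings K ρ x) : codeg (ball K ρ n) x y = 1 := by
  obtain ⟨p, hp, h⟩ := hL.apex_mem_ball hx hy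
  have hB := hK.card_eq_of_subset (ball_subset (K := K) (ρ := ρ) (n := n))
  have hpos : 0 < codeg (ball K ρ n) x y := codeg_pos.2 ⟨_, h, by simp, by simp⟩
  have hxy := (ne_of_triple_mem hB h).1
  -- A second triangle of the ball on this edge closes a cycle of length 3 or 4 in the link of `x`.
  -- Interiority of `x` is not assumed, so the argument also covers an outermost sphere that touches
  -- the boundary of the disc.
  by_contra hne
  obtain ⟨z, hzp, hz⟩ := exists_triple_ne_of_two_le_codeg hB hxy (by omega) p
  have hzK := (triple_mem_ball.1 hz)
  have hpK := (triple_mem_ball.1 h).1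
  rcases hρ.parents_or_siblings (mem_nbrs_of_triple hK.card_eq (triple_swap hzK.1)) (by omega)
    with hz' | hz'
  · exact hK.not_link_triangle hzK.1 (hL.parents_adj x hx z hz' p hp hzp) (triple_swap hpK)
  · obtain ⟨q, hq, hqz⟩ := hL.apex x hx z hz'
    by_cases hqp : q = p
    · subst hqp
      exact hK.not_link_triangle hzK.1 hqz (triple_swap hpK)
    · refine hK.not_link_square hzK.1 hqz (hL.parents_adj x hx q hq p hp hqp) (triple_swap hpK)
        ?_ hzp
      rintro rfl
      have := (mem_parents.1 hq).2
      have := (mem_siblings.1 hy).2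
      omega

theorem codeg_ball_parent (hρ : IsRadius K v ρ) {x p : W} (hint : IsInterior K x) (hx : ρ x = n)
    (hp : p ∈ parents K ρ x) : codeg (ball K ρ n) x p = 2 := by
  have h := mem_parents.1 hp
  rw [codeg_eq_of_forall ball_subset, hint p h.1]
  exact fun s hs _ hps => hρ.mem_ball_of_mem (x := p) (by omega) hs hps

theorem nbrs_ball (hL : IsLayer K ρ n) (hρ : IsRadius K v ρ) {x : W} (hint : IsInterior K x)
    (hx : ρ x = n) : nbrs (ball K ρ n) x = parents K ρ x ∪ siblings K ρ x := by
  ext y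
  rw [mem_union]
  constructor
  · intro hy
    obtain ⟨-, s, hs, -, hys⟩ := mem_nbrs.1 hy
    have hle := (mem_filter.1 hs).2 y hys
    exact hρ.parents_or_siblings (nbrs_mono ball_subset x hy) (by omega)
  · rintro (hy | hy)
    · have := codeg_ball_parent hρ hint hx hy
      exact mem_nbrs.2 ⟨(mem_nbrs.1 (mem_parents.1 hy).1).1, codeg_pos.1 (by omega)⟩
    · obtain ⟨p, -, h⟩ := hL.apex_mem_ball hx hy
      exact mem_nbrs.2 ⟨(mem_nbrs.1 (mem_siblings.1 hy).1).1, _, h, by simp, by simp⟩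

theorem disjoint_parents_siblings (x : W) : Disjoint (parents K ρ x) (siblings K ρ x) := by
  rw [Finset.disjoint_left]
  intro y h1 h2
  have := (mem_parents.1 h1).2
  have := (mem_siblings.1 h2).2
  omega

/-- The third vertex of a triangle at a vertex and one of its parents is a parent or a sibling. -/
theorem parents_or_siblings_of_triple (hK : IsRegularDisc K t) (hρ : IsRadius K v ρ) {x p y : W}
    (hp : p ∈ parents K ρ x) (h : {x, p, y} ∈ K) : y ∈ parents K ρ x ∨ y ∈ siblings K ρ x := by
  have h1 := mem_nbrs_of_triple hK.card_eq (triple_swap h)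
  have h2 := hρ.le_succ p y (mem_nbrs_of_triple hK.card_eq (triple_rotate h))
  have := (mem_parents.1 hp).2
  exact hρ.parents_or_siblings h1 (by omega)

/-- Each parent edge lies in two triangles, whose third vertices are parents or siblings. With one
parent both are siblings; with two parents, the two span a triangle with `x` and each gives one
further sibling, distinct since otherwise the link would have a 3-cycle. The apex property excludes
any others. -/
theorem card_siblings (hL : IsLayer K ρ n) (hK : IsRegularDisc K t) (hρ : IsRadius K v ρ)
    {x : W} (hint : IsInterior K x) (hx : ρ x = n) (hn : 1 ≤ n) : #(siblings K ρ x) = 2 := by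
  have two : ∀ p ∈ parents K ρ x, ∃ a b, a ≠ b ∧ {x, p, a} ∈ K ∧ {x, p, b} ∈ K ∧
      ∀ c, {x, p, c} ∈ K → c = a ∨ c = b := fun p hp =>
    exists_two_of_codeg_eq_two hK.card_eq (mem_nbrs.1 (mem_parents.1 hp).1).1.symm
      (hint p (mem_parents.1 hp).1)
  obtain ⟨p, hp⟩ := hρ.parents_nonempty (x := x) (by omega)
  obtain ⟨a, b, hab, ha, hb, hall⟩ := two p hp
  by_cases hk : ∃ q ∈ parents K ρ x, q ≠ p
  · obtain ⟨q, hq, hqp⟩ := hk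
    have hpar : ∀ r ∈ parents K ρ x, r = p ∨ r = q := by
      intro r hr
      by_contra! hne
      have := hL.card_parents_le hK hx
      have h3 : 2 < #(parents K ρ x) := two_lt_card_iff.2
        ⟨p, q, r, hp, hq, hr, hqp.symm, hne.1.symm, hne.2.symm⟩
      omega
    have hpq := hL.parents_adj x hx p hp q hq hqp.symm
    have other : ∀ p q, p ∈ parents K ρ x → (∀ r ∈ parents K ρ x, r = p ∨ r = q) →
        {x, p, q} ∈ K → ∃ y ∈ siblings K ρ x, {x, p, y} ∈ K ∧
          ∀ c, {x, p, c} ∈ K → c = q ∨ c = y := by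
      intro p q hp hpar hpq
      obtain ⟨a, b, hab, ha, hb, hall⟩ := two p hp
      have key : ∀ y, {x, p, y} ∈ K → y ≠ q → y ∈ siblings K ρ x := by
        intro y hy hyq
        refine (parents_or_siblings_of_triple hK hρ hp hy).resolve_left fun h => ?_
        rcases hpar y h with rfl | rfl
        · exact (ne_of_triple_mem hK.card_eq hy).2.2 rfl
        · exact hyq rfl
      rcases hall q hpq with rfl | rfl
      · exact ⟨b, key b hb hab.symm, hb, hall⟩
      · exact ⟨a, key a ha hab, ha, fun c hc => (hall c hc).symm⟩
    obtain ⟨y, hy, hpy, hyall⟩ := other p q hp hpar hpq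
    obtain ⟨z, hz, hqz, hzall⟩ := other q p hq (fun r hr => (hpar r hr).symm) (triple_swap hpq)
    have hyz : y ≠ z := by
      rintro rfl
      exact hK.not_link_triangle hpq hqz (triple_swap hpy)
    rw [card_eq_two]
    refine ⟨y, z, hyz, ?_⟩
    ext c
    simp only [mem_insert, Finset.mem_singleton]
    constructor
    · intro hc
      obtain ⟨r, hr, h⟩ := hL.apex x hx c hc
      have hcp := Finset.disjoint_right.1 (disjoint_parents_siblings x) hc
      rcases hpar r hr with rfl | rfl
      · rcases hyall c (triple_swap h) with rfl | rfl
        · exact absurd hq hcp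
        · exact Or.inl rfl
      · rcases hzall c (triple_swap h) with rfl | rfl
        · exact absurd hp hcp
        · exact Or.inr rfl
    · rintro (rfl | rfl) <;> assumption
  · push Not at hk
    have key : ∀ y, {x, p, y} ∈ K → y ∈ siblings K ρ x := by
      intro y hy
      refine (parents_or_siblings_of_triple hK hρ hp hy).resolve_left fun h => ?_
      exact (ne_of_triple_mem hK.card_eq hy).2.2 (hk y h).symm
    rw [card_eq_two]
    refine ⟨a, b, hab, ?_⟩
    ext c
    simp only [mem_insert, Finset.mem_singleton]
    constructor
    · intro hc
      obtain ⟨r, hr, h⟩ := hL.apex x hx c hc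
      rw [hk r hr] at h
      exact hall c (triple_swap h)
    · rintro (rfl | rfl)
      · exact key _ ha
      · exact key _ hb

theorem card_nbrs_ball (hL : IsLayer K ρ n) (hK : IsRegularDisc K t) (hρ : IsRadius K v ρ)
    {x : W} (hint : IsInterior K x) (hx : ρ x = n) (hn : 1 ≤ n) :
    #(nbrs (ball K ρ n) x) = #(parents K ρ x) + 2 := by
  rw [hL.nbrs_ball hρ hint hx, card_union_of_disjoint (disjoint_parents_siblings x),
    hL.card_siblings hK hρ hint hx hn]

theorem deg_ball (hL : IsLayer K ρ n) (hK : IsRegularDisc K t) (hρ : IsRadius K v ρ)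
    {x : W} (hint : IsInterior K x) (hx : ρ x = n) (hn : 1 ≤ n) :
    deg (ball K ρ n) x = #(parents K ρ x) + 1 := by
  have h := sum_codeg (hK.card_eq_of_subset (ball_subset (K := K) (ρ := ρ) (n := n))) x
  rw [hL.nbrs_ball hρ hint hx, sum_union (disjoint_parents_siblings x),
    sum_const_nat fun y hy => codeg_ball_parent hρ hint hx hy,
    sum_const_nat fun y hy => hL.codeg_ball_sibling hK hρ hx hy,
    hL.card_siblings hK hρ hint hx hn] at h
  omega

/-- The only boundary edges of the ball at `x` are those to its two siblings, so the general bound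
for boundary vertices is attained. -/
theorem curv_ball (hL : IsLayer K ρ n) (hK : IsRegularDisc K t) (hρ : IsRadius K v ρ)
    {x : W} (hint : IsInterior K x) (hx : ρ x = n) (hn : 1 ≤ n) :
    curv (ball K ρ n) x = 3 - deg (ball K ρ n) x := by
  have h1 := hL.card_nbrs_ball hK hρ hint hx hn
  have h2 := hL.deg_ball hK hρ hint hx hn
  rw [curv, if_pos (deg_pos.1 (by omega)), h1, h2]
  push_cast; ring

end IsLayer

end TriangleSet

/-! ### Filled balls and the induction for convexity -/

namespace TriangleSet

open scoped Classical
open Finset Finsupp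

variable {W : Type*} {K : Finset (Finset W)} {t : ℕ} {v : W} {ρ : W → ℕ} {n : ℕ}

/-- The ball of radius `n` together with everything enclosed by it and edges at vertices of `P`. -/
noncomputable def fillBall {W : Type*} (K : Finset (Finset W)) (ρ : W → ℕ) (n : ℕ) (P : Finset W) :
    Finset (Finset W) :=
  fill K (fun x y => (ρ x ≤ n ∨ x ∈ P) ∧ (ρ y ≤ n ∨ y ∈ P))

section FillBall

variable {P : Finset W}

theorem fillBall_subset : fillBall K ρ n P ⊆ K := fill_subset

theorem mem_fillBall {s : Finset W} (hs : s ∈ K) (h : ∀ x ∈ s, ρ x ≤ n ∨ x ∈ P) :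
    s ∈ fillBall K ρ n P := by
  refine subset_fill (Z := {s}) (by simpa using hs) ?_ (by simp)
  intro x y _ hc
  obtain ⟨r, hr, hx, hy⟩ := codeg_pos.1 (hc.symm ▸ one_pos)
  rw [Finset.mem_singleton] at hr
  subst hr
  exact ⟨h x hx, h y hy⟩

theorem of_codeg_fillBall {x y : W} (hxy : x ≠ y) (h : codeg (fillBall K ρ n P) x y = 1) :
    (ρ x ≤ n ∨ x ∈ P) ∧ (ρ y ≤ n ∨ y ∈ P) :=
  of_codeg_fill_eq_one (M := fun x y => (ρ x ≤ n ∨ x ∈ P) ∧ (ρ y ≤ n ∨ y ∈ P)) hxy h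

variable [Fintype W]

theorem ball_subset_fillBall : ball K ρ n ⊆ fillBall K ρ n P := fun _ hs =>
  mem_fillBall (ball_subset hs) fun x hx => Or.inl ((mem_filter.1 hs).2 x hx)

/-- The edges of `K` that join vertices of the ball or of `P`. -/
noncomputable def fillEdges (K : Finset (Finset W)) (ρ : W → ℕ) (n : ℕ) (P : Finset W) :
    Finset (Sym2 W) :=
  {e ∈ edges K | ∀ x ∈ e, ρ x ≤ n ∨ x ∈ P}

theorem mk_mem_fillEdges {x y : W} : s(x, y) ∈ fillEdges K ρ n P ↔
    y ∈ nbrs K x ∧ (ρ x ≤ n ∨ x ∈ P) ∧ (ρ y ≤ n ∨ y ∈ P) := by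
  rw [fillEdges, mem_filter, mk_mem_edges_iff_nbrs]
  simp

theorem edges_ball_subset : edges (ball K ρ n) ⊆ fillEdges K ρ n P := by
  intro e
  induction e with | _ x y =>
  rw [mk_mem_edges, mk_mem_fillEdges, mem_nbrs]
  rintro ⟨hxy, s, hs, hx, hy⟩
  have h := (mem_filter.1 hs).2
  exact ⟨⟨hxy.symm, s, ball_subset hs, hx, hy⟩, Or.inl (h x hx), Or.inl (h y hy)⟩

/-- The cycle bounds a region all of whose boundary edges are admissible, so the region is absorbed
by the filling. -/
theorem exists_mem_fillBall_of_cycle (hK : IsRegularDisc K t) {c : Sym2 W →₀ ZMod 2}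
    (hc : c ∈ supported (ZMod 2) (ZMod 2) (fillEdges K ρ n P : Set (Sym2 W)))
    (hc0 : bdOne W c = 0) {x y : W} (hxy : x ≠ y) (h : c s(x, y) ≠ 0) :
    ∃ s ∈ fillBall K ρ n P, x ∈ s ∧ y ∈ s := by
  obtain ⟨T, hT, hcT⟩ := hK.exists_support
    (supported_mono (by exact_mod_cast filter_subset _ _) hc) hc0
  obtain ⟨s, hs, hx⟩ := codeg_pos.1 (((hcT x y hxy).2 h).symm ▸ one_pos)
  refine ⟨s, subset_fill hT (fun a b hab h => ?_) hs, hx⟩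
  have hab' : s(a, b) ∈ fillEdges K ρ n P := by
    by_contra hne
    exact (hcT a b hab).1 h ((mem_supported' _ c).1 hc _ (by exact_mod_cast hne))
  exact (mk_mem_fillEdges.1 hab').2

/-- By maximality of the filling, any region glued along its boundary already belongs to it;
disjointness makes that region empty, as `six_le_sum_curv` requires. -/
theorem six_le_sum_curv_fillBall (hK : IsRegularDisc K t) (hne : (fillBall K ρ n P).Nonempty) :
    6 ≤ ∑ x, curv (fillBall K ρ n P) x := by
  refine hK.six_le_sum_curv fillBall_subset hne fun R hR hdis hb => ?_
  have : R ⊆ fillBall K ρ n P :=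
    subset_fill hR fun x y hxy h => of_codeg_fillBall hxy (hb x y hxy h)
  exact disjoint_self.1 (hdis.mono_right this)

/-- The change of curvature caused by filling. -/
noncomputable def curvDiff (K : Finset (Finset W)) (ρ : W → ℕ) (n : ℕ) (P : Finset W) (x : W) : ℤ :=
  curv (fillBall K ρ n P) x - curv (ball K ρ n) x

theorem sum_curvDiff_nonneg (hK : IsRegularDisc K t) (hρ : IsRadius K v ρ)
    (hne : (fillBall K ρ n P).Nonempty) : 0 ≤ ∑ x, curvDiff K ρ n P x := by
  have h1 := six_le_sum_curv_fillBall hK hne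
  have h2 := hρ.sum_curv_ball_le hK n
  simp only [curvDiff]
  rw [sum_sub_distrib]
  linarith

theorem curvDiff_of_lt (hρ : IsRadius K v ρ) {x : W} (hx : ρ x < n) :
    curvDiff K ρ n P x = 0 := by
  have h1 : ∀ s ∈ fillBall K ρ n P, x ∈ s → s ∈ ball K ρ n :=
    fun s hs hxs => hρ.mem_ball_of_mem hx (fillBall_subset hs) hxs
  have h2 := deg_eq_of_forall ball_subset_fillBall h1
  have h3 := nbrs_eq_of_forall ball_subset_fillBall h1
  have h4 : x ∈ verts (fillBall K ρ n P) ↔ x ∈ verts (ball K ρ n) := by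
    rw [← deg_pos, ← deg_pos, h2]
  simp only [curvDiff, curv, h2, h3, h4, sub_self]

theorem curv_ball_of_gt {x : W} (hx : n < ρ x) : curv (ball K ρ n) x = 0 := by
  refine IsRegularDisc.curv_eq_zero fun h => ?_
  obtain ⟨s, hs, hxs⟩ := mem_verts.1 h
  have := (mem_filter.1 hs).2 x hxs
  omega

theorem curvDiff_of_notMem (hK : IsRegularDisc K t) {x : W} (hx : n < ρ x) (hP : x ∉ P) :
    curvDiff K ρ n P x ≤ 0 := by
  rw [curvDiff, curv_ball_of_gt hx, sub_zero]
  refine hK.curv_nonpos_of_forall_codeg_ne_one fillBall_subset fun y hy h => ?_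
  rcases (of_codeg_fillBall hy.symm h).1 with h1 | h1
  · omega
  · exact hP h1

theorem curvDiff_of_mem_verts (hK : IsRegularDisc K t) {x : W} (hx : n < ρ x)
    (hv : x ∈ verts (fillBall K ρ n P)) :
    curvDiff K ρ n P x ≤ -1 ∨ curvDiff K ρ n P x ≤ 3 - deg (fillBall K ρ n P) x ∧
      ∃ y, y ≠ x ∧ codeg (fillBall K ρ n P) x y = 1 := by
  rw [curvDiff, curv_ball_of_gt hx, sub_zero]
  by_cases h : ∃ y, y ≠ x ∧ codeg (fillBall K ρ n P) x y = 1
  · obtain ⟨y, hy, h1⟩ := h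
    exact Or.inr ⟨hK.curv_le_of_codeg_eq_one fillBall_subset hy.symm h1, y, hy, h1⟩
  · push Not at h
    rw [hK.curv_eq_of_forall_codeg_ne_one fillBall_subset hv h]
    have := hK.le_degree
    exact Or.inl (by omega)

/-- Either `x` is swallowed, its curvature falling from `3 - deg ≥ 0` (at most two parents, so
degree at most 3) to `6 - t ≤ -1`, or it stays on the boundary and loses at least 1 for each added
triangle. -/
theorem curvDiff_sphere (hK : IsRegularDisc K t) (hρ : IsRadius K v ρ) (hn : 1 ≤ n)
    (hL : IsLayer K ρ n) {x : W} (hint : IsInterior K x) (hx : ρ x = n) :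
    (curvDiff K ρ n P x ≤ -1 ∧ ∀ y, y ≠ x → codeg (fillBall K ρ n P) x y ≠ 1) ∨
      curvDiff K ρ n P x ≤ deg (ball K ρ n) x - deg (fillBall K ρ n P) x := by
  rw [curvDiff, hL.curv_ball hK hρ hint hx hn]
  have hd := hL.deg_ball hK hρ hint hx hn
  have hp := hL.card_parents_le hK hx
  by_cases h : ∃ y, y ≠ x ∧ codeg (fillBall K ρ n P) x y = 1
  · obtain ⟨y, hy, h1⟩ := h
    have := hK.curv_le_of_codeg_eq_one fillBall_subset hy.symm h1
    exact Or.inr (by linarith)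
  · push Not at h
    rw [hK.curv_eq_of_forall_codeg_ne_one fillBall_subset
      (verts_mono ball_subset_fillBall (deg_pos.1 (by omega))) h]
    have := hK.le_degree
    exact Or.inl ⟨by omega, h⟩

theorem curvDiff_sphere_nonpos (hK : IsRegularDisc K t) (hρ : IsRadius K v ρ) (hn : 1 ≤ n)
    (hL : IsLayer K ρ n) {x : W} (hint : IsInterior K x) (hx : ρ x = n) :
    curvDiff K ρ n P x ≤ 0 := by
  have h := deg_mono (ball_subset_fillBall (K := K) (ρ := ρ) (n := n) (P := P)) x
  rcases curvDiff_sphere (P := P) hK hρ hn hL hint hx with h1 | h1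
  · linarith [h1.1]
  · omega

theorem curvDiff_sphere_neg (hK : IsRegularDisc K t) (hρ : IsRadius K v ρ) (hn : 1 ≤ n)
    (hL : IsLayer K ρ n) {x : W} (hint : IsInterior K x) (hx : ρ x = n) {s : Finset W}
    (hs : s ∈ fillBall K ρ n P) (hs' : s ∉ ball K ρ n) (hxs : x ∈ s) :
    curvDiff K ρ n P x ≤ -1 := by
  have h := deg_lt_deg ball_subset_fillBall hs hs' hxs
  rcases curvDiff_sphere (P := P) hK hρ hn hL hint hx with h1 | h1
  · exact h1.1
  · omega

/-- Outside `P`, filling does not increase curvature. -/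
theorem curvDiff_nonpos (hK : IsRegularDisc K t) (hρ : IsRadius K v ρ) (hn : 1 ≤ n)
    (hL : IsLayer K ρ n) (hint : ∀ x, ρ x ≤ n → IsInterior K x) {x : W} (hx : x ∉ P) :
    curvDiff K ρ n P x ≤ 0 := by
  rcases lt_trichotomy (ρ x) n with h | h | h
  · rw [curvDiff_of_lt hρ h]
  · exact curvDiff_sphere_nonpos hK hρ hn hL (hint x h.le) h
  · exact curvDiff_of_notMem hK h hx

theorem notMem_ball {s : Finset W} {x : W} (hx : n < ρ x) (hxs : x ∈ s) : s ∉ ball K ρ n := by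
  intro h
  have := (mem_filter.1 h).2 x hxs
  omega

end FillBall

variable [Fintype W]

/-- Two parents of a vertex span a triangle with it. -/
theorem IsLayer.parents_adj_succ (hK : IsRegularDisc K t) (hρ : IsRadius K v ρ) (hn : 1 ≤ n)
    (hL : IsLayer K ρ n) (hint : ∀ x, ρ x ≤ n → IsInterior K x) {w p q : W} (hw : ρ w = n + 1)
    (hp : p ∈ parents K ρ w) (hq : q ∈ parents K ρ w) (hpq : p ≠ q) : {w, p, q} ∈ K := by
  rw [mem_parents] at hp hq
  have hpn : ρ p = n := by omega
  have hqn : ρ q = n := by omega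
  have hwp := (mem_nbrs.1 hp.1).1.symm
  have hwq := (mem_nbrs.1 hq.1).1.symm
  -- Chains from `p` and `q` to the centre inside the ball, together with `wp` and `wq`, form a
  -- cycle; filling it puts triangles on both `wp` and `wq`.
  obtain ⟨g, hg, hgb⟩ := hρ.exists_chain (n := n) n le_rfl p hpn
  obtain ⟨g', hg', hgb'⟩ := hρ.exists_chain (n := n) n le_rfl q hqn
  have hsub := supported_mono (M := ZMod 2) (R := ZMod 2)
    (show (edges (ball K ρ n) : Set (Sym2 W)) ⊆ fillEdges K ρ n {w} by
      exact_mod_cast edges_ball_subset)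
  have hc : single s(w, p) 1 + single s(w, q) 1 + g + g' ∈
      supported (ZMod 2) (ZMod 2) (fillEdges K ρ n {w} : Set (Sym2 W)) := by
    refine add_mem (add_mem (add_mem ?_ ?_) (hsub hg)) (hsub hg')
    · exact single_mem_supported _ _ (mem_coe.2 (mk_mem_fillEdges.2
        ⟨hp.1, Or.inr (by simp), Or.inl hpn.le⟩))
    · exact single_mem_supported _ _ (mem_coe.2 (mk_mem_fillEdges.2
        ⟨hq.1, Or.inr (by simp), Or.inl hqn.le⟩))
  have hc0 : bdOne W (single s(w, p) 1 + single s(w, q) 1 + g + g') = 0 := by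
    simp only [map_add, bdOne_single, hgb, hgb']
    have h1 := chain_add_self (single w (1 : ZMod 2))
    have h2 := chain_add_self (single p (1 : ZMod 2))
    have h3 := chain_add_self (single q (1 : ZMod 2))
    have h4 := chain_add_self (single v (1 : ZMod 2))
    calc _ = (single w (1 : ZMod 2) + single w 1) + (single p 1 + single p 1)
        + (single q 1 + single q 1) + (single v 1 + single v 1) := by abel
      _ = 0 := by rw [h1, h2, h3, h4]; simp
  have hzero : ∀ g ∈ supported (ZMod 2) (ZMod 2) (edges (ball K ρ n) : Set (Sym2 W)), ∀ y,
      g s(w, y) = 0 := by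
    intro g hg y
    refine (mem_supported' _ g).1 hg _ fun h => ?_
    obtain ⟨-, s, hs, hws, -⟩ := mk_mem_edges.1 (mem_coe.1 h)
    exact notMem_ball (by omega) hws hs
  obtain ⟨s, hs, hws, hps⟩ := exists_mem_fillBall_of_cycle hK hc hc0 hwp (by
    simp [hzero g hg, hzero g' hg', hpq.symm, hwp])
  obtain ⟨r, hr, hwr, hqr⟩ := exists_mem_fillBall_of_cycle hK hc hc0 hwq (by
    simp [hzero g hg, hzero g' hg', hpq, hwq])
  have hsum := sum_curvDiff_nonneg hK hρ ⟨s, hs⟩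
  have hle := sum_univ_le_sum (f := curvDiff K ρ n {w}) {w, p, q} fun x hx =>
    curvDiff_nonpos hK hρ hn hL hint (by simp at hx ⊢; tauto)
  rw [sum_insert (by simp [hwp, hwq]), sum_insert (by simp [hpq]), sum_singleton] at hle
  have h1 := curvDiff_sphere_neg hK hρ hn hL (hint p hpn.le) hpn hs (notMem_ball (by omega) hws) hps
  have h2 := curvDiff_sphere_neg hK hρ hn hL (hint q hqn.le) hqn hr (notMem_ball (by omega) hwr) hqr
  -- Since `p` and `q` lose at least 1 each, `w` must gain at least 2. Its gain is at most 3 minus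
  -- its degree, so `w` lies in a single triangle, which contains both `p` and `q`.
  rcases curvDiff_of_mem_verts (P := {w}) hK (x := w) (n := n) (by omega)
    (mem_verts.2 ⟨s, hs, hws⟩) with h3 | ⟨h3, -⟩
  · omega
  · have hsr : s = r := card_le_one.1 (show deg (fillBall K ρ n {w}) w ≤ 1 by omega) s
      (by simp [hs, hws]) r (by simp [hr, hwr])
    subst hsr
    rw [← eq_triple (hK.card_eq s (fillBall_subset hs)) hws hps hqr hwp hwq hpq]
    exact fillBall_subset hs

/-- At an endpoint of an edge of the sphere whose endpoints have no common parent, filling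
decreases the curvature, summed over the endpoint and its parents. -/
theorem IsLayer.curvDiff_add_sum_parents_neg (hK : IsRegularDisc K t) (hρ : IsRadius K v ρ)
    (hn : 1 ≤ n) (hL : IsLayer K ρ n) (hint : ∀ x, ρ x ≤ n → IsInterior K x) {P : Finset W}
    {x y p : W} (hP : ∀ z, z ∈ P → z = x ∨ z = y) (hxP : x ∈ P) (hx : ρ x = n + 1)
    (hy : ρ y = n + 1) (hno : ∀ p ∈ parents K ρ x, y ∉ nbrs K p)
    (hs : ∃ s ∈ fillBall K ρ n P, x ∈ s ∧ y ∈ s) (hp : p ∈ parents K ρ x)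
    (hr : ∃ s ∈ fillBall K ρ n P, x ∈ s ∧ p ∈ s) :
    curvDiff K ρ n P x + ∑ q ∈ parents K ρ x, curvDiff K ρ n P q ≤ -1 := by
  obtain ⟨s, hs, hxs, hys⟩ := hs
  obtain ⟨r, hr, hxr, hpr⟩ := hr
  have hpar : ∀ q ∈ parents K ρ x, ρ q = n := fun q hq => by
    have := (mem_parents.1 hq).2; omega
  have hps : ∀ q ∈ parents K ρ x, ∀ s ∈ fillBall K ρ n P, q ∈ s → y ∉ s := by
    intro q hq s hs hqs hys
    refine hno q hq (mem_nbrs.2 ⟨?_, s, fillBall_subset hs, hqs, hys⟩)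
    rintro rfl
    have := hpar _ hq
    omega
  have hneg : ∀ q ∈ parents K ρ x, ∀ r ∈ fillBall K ρ n P, x ∈ r → q ∈ r →
      curvDiff K ρ n P q ≤ -1 := fun q hq r hr hxr hqr =>
    curvDiff_sphere_neg hK hρ hn hL (hint q (hpar q hq).le) (hpar q hq) hr
      (notMem_ball (by omega) hxr) hqr
  -- The triangles on `xy` and `xp` differ because `p` is not adjacent to `y`, so the contribution
  -- of `x` is at most `3 - 2 = 1`. The parents must therefore lose at least 2 together.
  have hdeg : 2 ≤ deg (fillBall K ρ n P) x := by
    have hsr : s ≠ r := fun h => hps p hp r hr hpr (h ▸ hys)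
    exact one_lt_card.2 ⟨s, by simp [hs, hxs], r, by simp [hr, hxr], hsr⟩
  have hx3 := curvDiff_of_mem_verts (P := P) hK (x := x) (n := n) (by omega)
    (mem_verts.2 ⟨s, hs, hxs⟩)
  by_cases hk : ∃ q ∈ parents K ρ x, q ≠ p
  · obtain ⟨q, hq, hqp⟩ := hk
    have hpq := hL.parents_adj_succ hK hρ hn hint hx hp hq hqp.symm
    have hpqU : {x, p, q} ∈ fillBall K ρ n P := by
      refine mem_fillBall hpq fun z hz => ?_
      simp only [mem_insert, Finset.mem_singleton] at hz
      rcases hz with rfl | rfl | rfl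
      · exact Or.inr hxP
      · exact Or.inl (hpar _ hp).le
      · exact Or.inl (hpar _ hq).le
    have hsub : {p, q} ⊆ parents K ρ x := by
      intro z; simp only [mem_insert, Finset.mem_singleton]; rintro (rfl | rfl) <;> assumption
    have hle : ∑ q ∈ parents K ρ x, curvDiff K ρ n P q ≤ ∑ q ∈ {p, q}, curvDiff K ρ n P q := by
      rw [← Finset.sum_sdiff hsub]
      have : ∑ z ∈ parents K ρ x \ {p, q}, curvDiff K ρ n P z ≤ 0 :=
        Finset.sum_nonpos fun z hz => curvDiff_sphere_nonpos hK hρ hn hL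
          (hint z (hpar z (mem_sdiff.1 hz).1).le) (hpar z (mem_sdiff.1 hz).1)
      linarith
    rw [sum_pair hqp.symm] at hle
    have h1 := hneg p hp _ hpqU (by simp) (by simp)
    have h2 := hneg q hq _ hpqU (by simp) (by simp)
    rcases hx3 with h3 | ⟨h3, -⟩ <;> omega
  · push Not at hk
    have hsing : parents K ρ x = {p} := by
      ext z; rw [Finset.mem_singleton]; exact ⟨hk z, fun h => h ▸ hp⟩
    rw [hsing, sum_singleton]
    have h1 := hneg p hp r hr hxr hpr
    rcases hx3 with h3 | ⟨h3, b, hbx, hb⟩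
    · omega
    have hU3 := hK.card_eq_of_subset (fillBall_subset (K := K) (ρ := ρ) (n := n) (P := P))
    have hU2 := hK.codeg_le_of_subset (fillBall_subset (K := K) (ρ := ρ) (n := n) (P := P))
    -- With a single parent, boundary edges of the filling at `x` can only lead to `p` or `y`; by
    -- parity `xp` is one of them, which keeps `p` on the boundary.
    have hbd : ∀ z, z ≠ x → codeg (fillBall K ρ n P) x z = 1 → z = p ∨ z = y := by
      intro z hz h
      have hzn : z ∈ nbrs K x := nbrs_mono fillBall_subset x
        (mem_nbrs.2 ⟨hz, codeg_pos.1 (h.symm ▸ one_pos)⟩)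
      rcases (of_codeg_fillBall hz.symm h).2 with h | h
      · have := hρ.le_succ z x (mem_nbrs_comm.1 hzn)
        exact Or.inl (hk z (mem_parents.2 ⟨hzn, by omega⟩))
      · exact Or.inr ((hP z h).resolve_left hz)
    have hxp : codeg (fillBall K ρ n P) x p = 1 := by
      obtain ⟨c, hcx, hcb, hc⟩ := exists_other_boundary hU3 hU2 hbx.symm hb
      rcases hbd b hbx hb with rfl | rfl
      · exact hb
      · rcases hbd c hcx hc with rfl | rfl
        · exact hc
        · exact absurd rfl hcb
    have hpx := (mem_nbrs.1 (mem_parents.1 hp).1).1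
    rcases curvDiff_sphere (P := P) hK hρ hn hL (hint p (hpar p hp).le) (hpar p hp)
      with h4 | h4
    · exact absurd ((codeg_comm _ p x).trans hxp) (h4.2 x hpx.symm)
    obtain ⟨z, hxz, hpz, rfl⟩ := exists_eq_triple (hU3 r hr) hxr hpr hpx.symm
    have hrK := fillBall_subset hr
    have hzx : z ∈ nbrs K x := mem_nbrs_of_triple hK.card_eq (triple_swap hrK)
    have hzp : z ∈ nbrs K p := mem_nbrs_of_triple hK.card_eq (triple_rotate hrK)
    have hzn : ρ z = n + 1 := by
      have h5 := hρ.le_succ z x (mem_nbrs_comm.1 hzx)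
      have h6 := hρ.le_succ p z hzp
      have h7 := hpar p hp
      have h8 : ρ z ≠ n := fun h => hpz (hk z (mem_parents.2 ⟨hzx, by omega⟩)).symm
      omega
    have hzy : z ≠ y := by
      rintro rfl
      exact hps p hp _ hr (by simp) (by simp)
    -- The vertex `z` lies outside both the ball and `P`, so `pz` cannot be a boundary edge of the
    -- filling. Both triangles on it are new at `p`, which loses 2.
    have hpz2 : codeg (fillBall K ρ n P) p z = 2 := by
      have h5 := hU2 p z hpz
      have h6 : 0 < codeg (fillBall K ρ n P) p z := codeg_pos.2 ⟨_, hr, by simp, by simp⟩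
      have h7 : codeg (fillBall K ρ n P) p z ≠ 1 := by
        intro h
        rcases (of_codeg_fillBall hpz h).2 with h | h
        · omega
        · rcases hP z h with rfl | rfl
          · exact hxz rfl
          · exact hzy rfl
      omega
    have hdeg2 : deg (ball K ρ n) p + 2 ≤ deg (fillBall K ρ n P) p := by
      have h5 : codeg (fillBall K ρ n P) p z + deg (ball K ρ n) p ≤ deg (fillBall K ρ n P) p := by
        rw [codeg, deg, deg, ← card_union_of_disjoint]
        · apply card_le_card
          intro s
          simp only [mem_union, mem_filter]
          rintro (h | h)
          · exact ⟨h.1, h.2.1⟩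
          · exact ⟨ball_subset_fillBall h.1, h.2⟩
        · rw [Finset.disjoint_left]
          intro s h h'
          simp only [mem_filter] at h h'
          exact notMem_ball (by omega) h.2.2 h'.1
      omega
    omega

/-- The endpoints of an edge of the sphere have a common parent. -/
theorem IsLayer.exists_common_parent (hK : IsRegularDisc K t) (hρ : IsRadius K v ρ)
    (hn : 1 ≤ n) (hL : IsLayer K ρ n) (hint : ∀ x, ρ x ≤ n → IsInterior K x) {a b : W}
    (ha : ρ a = n + 1) (hb : b ∈ siblings K ρ a) : ∃ p ∈ parents K ρ a, b ∈ nbrs K p := by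
  by_contra! hno
  rw [mem_siblings] at hb
  have hbn : ρ b = n + 1 := by omega
  have hab := (mem_nbrs.1 hb.1).1.symm
  obtain ⟨p, hp⟩ := hρ.parents_nonempty (x := a) (by omega)
  obtain ⟨q, hq⟩ := hρ.parents_nonempty (x := b) (by omega)
  have hpn := (mem_parents.1 hp).2
  have hqn := (mem_parents.1 hq).2
  have hap := (mem_nbrs.1 (mem_parents.1 hp).1).1.symm
  have hbq := (mem_nbrs.1 (mem_parents.1 hq).1).1.symm
  have hbp : b ≠ p := by rintro rfl; omega
  have haq : a ≠ q := by rintro rfl; omega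
  -- The cycle to be filled runs from the centre through `p`, `a`, `b`, `q` and back.
  obtain ⟨g, hg, hgb⟩ := hρ.exists_chain (n := n) n le_rfl p (by omega)
  obtain ⟨g', hg', hgb'⟩ := hρ.exists_chain (n := n) n le_rfl q (by omega)
  have hsub := supported_mono (M := ZMod 2) (R := ZMod 2)
    (show (edges (ball K ρ n) : Set (Sym2 W)) ⊆ fillEdges K ρ n {a, b} by
      exact_mod_cast edges_ball_subset)
  have hc : single s(a, b) 1 + single s(a, p) 1 + single s(b, q) 1 + g + g' ∈
      supported (ZMod 2) (ZMod 2) (fillEdges K ρ n {a, b} : Set (Sym2 W)) := by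
    refine add_mem (add_mem (add_mem (add_mem ?_ ?_) ?_) (hsub hg)) (hsub hg') <;>
      refine single_mem_supported _ _ (mem_coe.2 (mk_mem_fillEdges.2 ⟨?_, Or.inr (by simp), ?_⟩))
    · exact hb.1
    · exact Or.inr (by simp)
    · exact (mem_parents.1 hp).1
    · exact Or.inl (by omega)
    · exact (mem_parents.1 hq).1
    · exact Or.inl (by omega)
  have hc0 : bdOne W (single s(a, b) 1 + single s(a, p) 1 + single s(b, q) 1 + g + g') = 0 := by
    simp only [map_add, bdOne_single, hgb, hgb']
    have h1 := chain_add_self (single a (1 : ZMod 2))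
    have h2 := chain_add_self (single p (1 : ZMod 2))
    have h3 := chain_add_self (single q (1 : ZMod 2))
    have h4 := chain_add_self (single v (1 : ZMod 2))
    have h5 := chain_add_self (single b (1 : ZMod 2))
    calc _ = (single a (1 : ZMod 2) + single a 1) + (single b 1 + single b 1)
        + (single p 1 + single p 1) + (single q 1 + single q 1) + (single v 1 + single v 1) := by
          abel
      _ = 0 := by rw [h1, h2, h3, h4, h5]; simp
  have hzero : ∀ g ∈ supported (ZMod 2) (ZMod 2) (edges (ball K ρ n) : Set (Sym2 W)), ∀ x y,
      ρ x = n + 1 → g s(x, y) = 0 := by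
    intro g hg x y hx
    refine (mem_supported' _ g).1 hg _ fun h => ?_
    obtain ⟨-, s, hs, hws, -⟩ := mk_mem_edges.1 (mem_coe.1 h)
    exact notMem_ball (by omega) hws hs
  obtain ⟨s, hs, has, hbs⟩ := exists_mem_fillBall_of_cycle hK hc hc0 hab (by
    simp [hzero g hg a b ha, hzero g' hg' a b ha, hab, hab.symm, hbp, haq])
  have hr := exists_mem_fillBall_of_cycle hK hc hc0 hap (by
    simp [hzero g hg a p ha, hzero g' hg' a p ha, hab, hbp.symm, haq])
  have hr' := exists_mem_fillBall_of_cycle hK hc hc0 hbq (by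
    simp [hzero g hg b q hbn, hzero g' hg' b q hbn, hab.symm, hbp, haq.symm])
  have h1 := hL.curvDiff_add_sum_parents_neg hK hρ hn hint (P := {a, b}) (x := a) (y := b)
    (by simp) (by simp) ha hbn hno ⟨s, hs, has, hbs⟩ hp hr
  have h2 := hL.curvDiff_add_sum_parents_neg hK hρ hn hint (P := {a, b}) (x := b) (y := a)
    (by simp [or_comm]) (by simp) hbn ha (fun z hz hza => by
      rw [mem_parents] at hz
      exact hno z (mem_parents.2 ⟨mem_nbrs_comm.1 hza, by omega⟩) (mem_nbrs_comm.1 hz.1))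
    ⟨s, hs, hbs, has⟩ hq hr'
  have hsum := sum_curvDiff_nonneg hK hρ ⟨s, hs⟩
  have hle := sum_univ_le_sum (f := curvDiff K ρ n {a, b})
    ({a, b} ∪ (parents K ρ a ∪ parents K ρ b)) fun x hx =>
      curvDiff_nonpos hK hρ hn hL hint fun h => hx (mem_union_left _ h)
  -- Without a common parent the two local losses involve disjoint sets of vertices, so the total
  -- change is at most -2, against `sum_curvDiff_nonneg`.
  have hd1 : Disjoint (parents K ρ a) (parents K ρ b) := by
    rw [Finset.disjoint_left]
    intro z hz hz'
    exact hno z hz (mem_nbrs_comm.1 (mem_parents.1 hz').1)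
  have hd2 : Disjoint {a, b} (parents K ρ a ∪ parents K ρ b) := by
    rw [Finset.disjoint_left]
    intro z hz hz'
    simp only [mem_insert, Finset.mem_singleton, mem_union, mem_parents] at hz hz'
    rcases hz with rfl | rfl <;> omega
  rw [sum_union hd2, sum_union hd1, sum_pair hab] at hle
  linarith

theorem IsLayer.succ (hK : IsRegularDisc K t) (hρ : IsRadius K v ρ) (hn : 1 ≤ n)
    (hL : IsLayer K ρ n) (hint : ∀ x, ρ x ≤ n → IsInterior K x) : IsLayer K ρ (n + 1) where
  parents_adj _ hx _ hp _ hq hpq := hL.parents_adj_succ hK hρ hn hint hx hp hq hpq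
  apex x hx y hy := by
    obtain ⟨p, hp, h⟩ := hL.exists_common_parent hK hρ hn hint hx hy
    exact ⟨p, hp, hK.triple_mem (mem_siblings.1 hy).1 (mem_parents.1 hp).1 (mem_nbrs_comm.1 h)⟩

/-- On the first sphere the centre is the only parent, and an edge of that sphere forms a 3-cycle
with it, which is filled by a triangle. -/
theorem isLayer_one (hK : IsRegularDisc K t) (hρ : IsRadius K v ρ) : IsLayer K ρ 1 := by
  have hpar : ∀ x, ρ x = 1 → ∀ p ∈ parents K ρ x, p = v := fun x hx p hp => by
    have := (mem_parents.1 hp).2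
    exact (hρ.eq_zero_iff p).1 (by omega)
  refine ⟨fun x hx p hp q hq hpq => absurd ((hpar x hx p hp).trans (hpar x hx q hq).symm) hpq,
    fun x hx y hy => ?_⟩
  rw [mem_siblings] at hy
  obtain ⟨p, hp⟩ := hρ.parents_nonempty (x := x) (by omega)
  obtain ⟨q, hq⟩ := hρ.parents_nonempty (x := y) (by omega)
  have h1 := hpar x hx p hp
  have h2 := hpar y (by omega) q hq
  subst h2
  subst h1
  exact ⟨p, hp, hK.triple_mem hy.1 (mem_parents.1 hp).1 (mem_parents.1 hq).1⟩

/-- Every sphere around `v` that is not cut off by the boundary is a layer. -/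
theorem isLayer (hK : IsRegularDisc K t) (hρ : IsRadius K v ρ) (hn : 1 ≤ n)
    (hint : ∀ x, ρ x < n → IsInterior K x) : IsLayer K ρ n := by
  induction n, hn using Nat.le_induction with
  | base => exact isLayer_one hK hρ
  | succ n hn ih =>
    exact (ih fun x hx => hint x (by omega)).succ hK hρ hn fun x hx => hint x (by omega)

end TriangleSet

/-! ### Counting triangles between consecutive spheres -/

namespace TriangleSet

open scoped Classical
open Finset

variable {W : Type*} [Fintype W] {K : Finset (Finset W)} {t : ℕ} {v : W} {ρ : W → ℕ} {n : ℕ}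

/-- The edges of `K` both of whose endpoints have radius `n`. -/
noncomputable def sphereEdges (K : Finset (Finset W)) (ρ : W → ℕ) (n : ℕ) : Finset (Sym2 W) :=
  {e ∈ edges K | ∀ x ∈ e, ρ x = n}

/-- The triangles between the spheres of radius `n` and `n + 1`. -/
noncomputable def shell (K : Finset (Finset W)) (ρ : W → ℕ) (n : ℕ) : Finset (Finset W) :=
  ball K ρ (n + 1) \ ball K ρ n

theorem mk_mem_sphereEdges {x y : W} :
    s(x, y) ∈ sphereEdges K ρ n ↔ y ∈ siblings K ρ x ∧ ρ x = n := by
  simp only [sphereEdges, mem_filter, mk_mem_edges_iff_nbrs, mem_siblings, Sym2.mem_iff,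
    forall_eq_or_imp, forall_eq]
  constructor
  · rintro ⟨h1, h2, h3⟩; exact ⟨⟨h1, h3.trans h2.symm⟩, h2⟩
  · rintro ⟨⟨h1, h2⟩, h3⟩; exact ⟨h1, h3, h2.trans h3⟩

theorem ball_subset_ball_succ : ball K ρ n ⊆ ball K ρ (n + 1) := fun s hs => by
  simp only [ball, mem_filter] at hs ⊢
  exact ⟨hs.1, fun x hx => (hs.2 x hx).trans n.le_succ⟩

theorem shell_subset : shell K ρ n ⊆ K := sdiff_subset.trans ball_subset

theorem disjoint_ball_shell : Disjoint (ball K ρ n) (shell K ρ n) := disjoint_sdiff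

theorem ball_union_shell : ball K ρ n ∪ shell K ρ n = ball K ρ (n + 1) :=
  union_sdiff_of_subset ball_subset_ball_succ

theorem sum_card_siblings (K : Finset (Finset W)) (ρ : W → ℕ) (n : ℕ) :
    ∑ x with ρ x = n, #(siblings K ρ x) = 2 * #(sphereEdges K ρ n) := by
  have h : ∀ x ∈ ({x | ρ x = n} : Finset W),
      #(siblings K ρ x) = #(bipartiteAbove (fun x e => x ∈ e) (sphereEdges K ρ n) x) := by
    intro x hx
    refine card_bij (fun y _ => s(x, y)) ?_ ?_ ?_
    · intro y hy
      simp only [bipartiteAbove, mem_filter, mk_mem_sphereEdges]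
      exact ⟨⟨hy, (mem_filter.1 hx).2⟩, by simp⟩
    · intro y _ z _ h
      exact Sym2.congr_right.1 h
    · intro e he
      simp only [bipartiteAbove, mem_filter] at he
      obtain ⟨y, rfl⟩ := he.2
      exact ⟨y, (mk_mem_sphereEdges.1 he.1).1, rfl⟩
  rw [sum_congr rfl h, sum_card_bipartiteAbove_eq_sum_card_bipartiteBelow,
    sum_const_nat (m := 2), mul_comm]
  intro e he
  induction e with | _ x y =>
  obtain ⟨h1, hx⟩ := mk_mem_sphereEdges.1 he
  obtain ⟨h1, hy⟩ := mem_siblings.1 h1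
  have : bipartiteBelow (fun x e => x ∈ e) ({x | ρ x = n} : Finset W) s(x, y) = {x, y} := by
    ext z
    simp only [bipartiteBelow, mem_filter, mem_univ, true_and, Sym2.mem_iff, mem_insert,
      mem_singleton, and_iff_right_iff_imp]
    rintro (rfl | rfl) <;> omega
  rw [this, card_pair (mem_nbrs.1 h1).1.symm]

theorem sum_deg_sphere (T : Finset (Finset W)) (ρ : W → ℕ) (n : ℕ) :
    ∑ x with ρ x = n, deg T x = ∑ s ∈ T, #{x ∈ s | ρ x = n} := by
  have h : ∀ x ∈ ({x | ρ x = n} : Finset W), deg T x = #(bipartiteAbove (fun x s => x ∈ s) T x) :=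
    fun x _ => rfl
  rw [sum_congr rfl h, sum_card_bipartiteAbove_eq_sum_card_bipartiteBelow]
  refine sum_congr rfl fun s _ => congrArg card ?_
  ext x
  simp [bipartiteBelow, and_comm]

/-- If every edge of a sphere lies in exactly one triangle of `T`, then the edges of the sphere
correspond to the triangles of `T` with exactly two vertices on it. -/
theorem card_sphereEdges_eq {T : Finset (Finset W)} (hT : T ⊆ K)
    (h1 : ∀ x y, ρ x = n → y ∈ siblings K ρ x → codeg T x y = 1)
    (h2 : ∀ s ∈ T, #{x ∈ s | ρ x = n} ≤ 2) :
    #(sphereEdges K ρ n) = #{s ∈ T | #{x ∈ s | ρ x = n} = 2} := by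
  have h := sum_card_bipartiteAbove_eq_sum_card_bipartiteBelow (s := sphereEdges K ρ n)
    (t := {s ∈ T | #{x ∈ s | ρ x = n} = 2}) (fun e s => ∀ x ∈ e, x ∈ s)
  rw [sum_const_nat (m := 1), sum_const_nat (m := 1), mul_one, mul_one] at h
  · exact h
  · intro s hs
    obtain ⟨hsT, hs2⟩ := mem_filter.1 hs
    obtain ⟨x, y, hxy, hs2⟩ := card_eq_two.1 hs2
    have hmem : ∀ z, z = x ∨ z = y ↔ z ∈ s ∧ ρ z = n := by
      intro z
      have : z ∈ ({z ∈ s | ρ z = n} : Finset W) ↔ z ∈ ({x, y} : Finset W) := by rw [hs2]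
      simpa [eq_comm] using this.symm
    rw [card_eq_one]
    refine ⟨s(x, y), ?_⟩
    have hx := (hmem x).1 (Or.inl rfl)
    have hy := (hmem y).1 (Or.inr rfl)
    ext e
    induction e with | _ a b =>
    simp only [bipartiteBelow, mem_filter, mem_singleton, mk_mem_sphereEdges, mem_siblings,
      Sym2.mem_iff, forall_eq_or_imp, forall_eq, Sym2.eq_iff]
    constructor
    · rintro ⟨⟨⟨hab, hρ⟩, ha⟩, has, hbs⟩
      have hne := (mem_nbrs.1 hab).1
      have h3 := (hmem a).2 ⟨has, ha⟩
      have h4 := (hmem b).2 ⟨hbs, by omega⟩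
      rcases h3 with rfl | rfl <;> rcases h4 with rfl | rfl <;> simp_all
    · rintro (⟨rfl, rfl⟩ | ⟨rfl, rfl⟩)
      · exact ⟨⟨⟨mem_nbrs.2 ⟨hxy.symm, s, hT hsT, hx.1, hy.1⟩, by omega⟩, hx.2⟩, hx.1, hy.1⟩
      · exact ⟨⟨⟨mem_nbrs.2 ⟨hxy, s, hT hsT, hy.1, hx.1⟩, by omega⟩, hy.2⟩, hy.1, hx.1⟩
  · intro e he
    induction e with | _ x y =>
    obtain ⟨hy, hx⟩ := mk_mem_sphereEdges.1 he
    rw [← h1 x y hx hy, codeg]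
    congr 1
    ext s
    simp only [bipartiteAbove, mem_filter, Sym2.mem_iff, forall_eq_or_imp, forall_eq]
    constructor
    · rintro ⟨⟨h3, -⟩, h4⟩; exact ⟨h3, h4⟩
    · rintro ⟨h3, h4⟩
      refine ⟨⟨h3, le_antisymm (h2 s h3) ?_⟩, h4⟩
      rw [mem_siblings] at hy
      rw [← card_pair (mem_nbrs.1 hy.1).1.symm]
      apply card_le_card
      intro z
      simp only [mem_insert, mem_singleton, mem_filter]
      rintro (rfl | rfl)
      · exact ⟨h4.1, hx⟩
      · exact ⟨h4.2, by omega⟩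

theorem card_add_card_of_mem_shell (hK : IsRegularDisc K t) (hρ : IsRadius K v ρ) {s : Finset W}
    (hs : s ∈ shell K ρ n) :
    #{x ∈ s | ρ x = n} + #{x ∈ s | ρ x = n + 1} = 3 ∧ 1 ≤ #{x ∈ s | ρ x = n + 1} := by
  obtain ⟨h1, h2⟩ := mem_sdiff.1 hs
  obtain ⟨hsK, h1⟩ := mem_filter.1 h1
  have hlt : ∀ x ∈ s, n ≤ ρ x := fun x hx => by
    by_contra! h
    exact h2 (hρ.mem_ball_of_mem h hsK hx)
  constructor
  · rw [← hK.card_eq s hsK, ← card_union_of_disjoint, ← filter_or, filter_true_of_mem]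
    · intro x hx
      have := hlt x hx
      have := h1 x hx
      omega
    · rw [disjoint_filter]; intro x _ h; omega
  · rw [Nat.one_le_iff_ne_zero, ← pos_iff_ne_zero, card_pos]
    by_contra h
    refine h2 (mem_filter.2 ⟨hsK, fun x hx => ?_⟩)
    have h3 : x ∉ ({x ∈ s | ρ x = n + 1} : Finset W) := fun hx => h ⟨x, hx⟩
    have h4 := h1 x hx
    simp only [mem_filter, hx, true_and] at h3
    omega

/-- No triangle has all its vertices on a layer. -/
theorem IsLayer.card_filter_le (hL : IsLayer K ρ n) (hK : IsRegularDisc K t) (hρ : IsRadius K v ρ)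
    {s : Finset W} (hs : s ∈ K) : #{x ∈ s | ρ x = n} ≤ 2 := by
  by_contra! h
  obtain ⟨x, y, z, hx, hy, hz, hxy, hxz, hyz⟩ := two_lt_card_iff.1 h
  simp only [mem_filter] at hx hy hz
  have hsib : y ∈ siblings K ρ x :=
    mem_siblings.2 ⟨mem_nbrs.2 ⟨hxy.symm, s, hs, hx.1, hy.1⟩, by omega⟩
  have h1 := hL.codeg_ball_sibling hK hρ hx.2 hsib
  obtain ⟨p, hp, hpB⟩ := hL.apex_mem_ball hx.2 hsib
  have hpn := (mem_parents.1 hp).2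
  have hsB : {x, y, z} ∈ ball K ρ n := by
    rw [triple_mem_ball, ← eq_triple (hK.card_eq s hs) hx.1 hy.1 hz.1 hxy hxz hyz]
    exact ⟨hs, hx.2.le, hy.2.le, hz.2.le⟩
  have hzp : z ≠ p := by rintro rfl; omega
  obtain ⟨n1, n2, n3⟩ := ne_of_triple_mem (hK.card_eq_of_subset ball_subset) hpB
  have := two_le_codeg hzp n2 n3 hsB hpB
  omega

theorem card_sphereEdges_succ (hL : IsLayer K ρ (n + 1)) (hK : IsRegularDisc K t)
    (hρ : IsRadius K v ρ) :
    #(sphereEdges K ρ (n + 1)) = #{s ∈ shell K ρ n | #{x ∈ s | ρ x = n + 1} = 2} := by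
  refine card_sphereEdges_eq shell_subset (fun x y hx hy => ?_)
    fun s hs => hL.card_filter_le hK hρ (shell_subset hs)
  rw [← hL.codeg_ball_sibling hK hρ hx hy, ← ball_union_shell,
    codeg_add_of_disjoint disjoint_ball_shell]
  have : codeg (ball K ρ n) x y = 0 := by
    by_contra h
    obtain ⟨s, hs, hxs, -⟩ := codeg_pos.1 (Nat.pos_of_ne_zero h)
    exact notMem_ball (by omega) hxs hs
  omega

theorem card_sphereEdges_zero (hρ : IsRadius K v ρ) : #(sphereEdges K ρ 0) = 0 := by
  rw [card_eq_zero, eq_empty_iff_forall_notMem]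
  intro e he
  induction e with | _ x y =>
  obtain ⟨hy, hx⟩ := mk_mem_sphereEdges.1 he
  rw [mem_siblings] at hy
  exact (mem_nbrs.1 hy.1).1 (((hρ.eq_zero_iff y).1 (by omega)).trans
    ((hρ.eq_zero_iff x).1 hx).symm)

theorem ball_zero (hK : IsRegularDisc K t) (hρ : IsRadius K v ρ) : ball K ρ 0 = ∅ := by
  rw [eq_empty_iff_forall_notMem]
  intro s hs
  obtain ⟨hs, h⟩ := mem_filter.1 hs
  have : #s ≤ 1 := card_le_one.2 fun a ha b hb =>
    ((hρ.eq_zero_iff a).1 (Nat.le_zero.1 (h a ha))).trans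
      ((hρ.eq_zero_iff b).1 (Nat.le_zero.1 (h b hb))).symm
  rw [hK.card_eq s hs] at this
  omega

/-- An edge of the inner sphere lies in two triangles of `K`, exactly one of them inside the ball,
so exactly one in the shell. At radius 0 there are no edges. -/
theorem card_sphereEdges_eq_shell (hL' : IsLayer K ρ (n + 1)) (hK : IsRegularDisc K t)
    (hρ : IsRadius K v ρ) (hint : ∀ x, ρ x ≤ n → IsInterior K x) :
    #(sphereEdges K ρ n) = #{s ∈ shell K ρ n | #{x ∈ s | ρ x = n} = 2} := by
  refine card_sphereEdges_eq shell_subset (fun x y hx hy => ?_) fun s hs => by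
    have := card_add_card_of_mem_shell hK hρ hs; omega
  rcases Nat.eq_zero_or_pos n with h0 | hn
  · have h1 := card_eq_zero.1 (card_sphereEdges_zero hρ)
    subst h0
    have : s(x, y) ∈ sphereEdges K ρ 0 := mk_mem_sphereEdges.2 ⟨hy, hx⟩
    rw [h1] at this
    simp at this
  · have hL := isLayer hK hρ hn fun x hx => hint x hx.le
    have h1 := hL.codeg_ball_sibling hK hρ hx hy
    have h2 := codeg_add_of_disjoint (disjoint_ball_shell (K := K) (ρ := ρ) (n := n)) x y
    have h3 : codeg (ball K ρ (n + 1)) x y = codeg K x y :=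
      codeg_eq_of_forall ball_subset fun s hs hxs _ =>
        hρ.mem_ball_of_mem (by omega : ρ x < n + 1) hs hxs
    rw [ball_union_shell, h3, hint x hx.le y (mem_siblings.1 hy).1] at h2
    omega

/-- The vertices of a shell triangle split as 2 + 1 or 1 + 2 between the two spheres, and the two
kinds are counted by the inner and the outer sphere edges. -/
theorem sum_card_shell (hL : IsLayer K ρ (n + 1)) (hK : IsRegularDisc K t)
    (hρ : IsRadius K v ρ) (hint : ∀ x, ρ x ≤ n → IsInterior K x) :
    #(shell K ρ n) = #(sphereEdges K ρ n) + #(sphereEdges K ρ (n + 1)) ∧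
    ∑ s ∈ shell K ρ n, #{x ∈ s | ρ x = n} =
      2 * #(sphereEdges K ρ n) + #(sphereEdges K ρ (n + 1)) ∧
    ∑ s ∈ shell K ρ n, #{x ∈ s | ρ x = n + 1} =
      #(sphereEdges K ρ n) + 2 * #(sphereEdges K ρ (n + 1)) := by
  rw [card_sphereEdges_succ hL hK hρ, card_sphereEdges_eq_shell hL hK hρ hint, card_filter,
    card_filter, card_eq_sum_ones, mul_sum, mul_sum, ← sum_add_distrib, ← sum_add_distrib,
    ← sum_add_distrib]
  refine ⟨sum_congr rfl fun s hs => ?_, sum_congr rfl fun s hs => ?_, sum_congr rfl fun s hs => ?_⟩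
  all_goals
    have h1 := card_add_card_of_mem_shell hK hρ hs
    have h2 := hL.card_filter_le hK hρ (shell_subset hs)
    split_ifs <;> omega

theorem card_ball_succ (hL : IsLayer K ρ (n + 1)) (hK : IsRegularDisc K t)
    (hρ : IsRadius K v ρ) (hint : ∀ x, ρ x ≤ n → IsInterior K x) :
    #(ball K ρ (n + 1)) =
      #(ball K ρ n) + #(sphereEdges K ρ n) + #(sphereEdges K ρ (n + 1)) := by
  rw [← ball_union_shell, card_union_of_disjoint disjoint_ball_shell,
    (sum_card_shell hL hK hρ hint).1, add_assoc]

theorem sum_deg_ball_succ (hL : IsLayer K ρ (n + 1)) (hK : IsRegularDisc K t)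
    (hρ : IsRadius K v ρ) (hint : ∀ x, ρ x ≤ n → IsInterior K x) :
    ∑ x with ρ x = n + 1, deg (ball K ρ (n + 1)) x =
      #(sphereEdges K ρ n) + 2 * #(sphereEdges K ρ (n + 1)) := by
  rw [sum_deg_sphere, ← ball_union_shell, sum_union disjoint_ball_shell,
    (sum_card_shell hL hK hρ hint).2.2, Nat.add_eq_right]
  refine sum_eq_zero fun s hs => ?_
  rw [card_eq_zero, filter_eq_empty_iff]
  intro x hx
  have := (mem_filter.1 hs).2 x hx
  omega

/-- The `t` triangles at a vertex of the sphere lie either in the ball or in the shell outside it;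
summing over the sphere brings in the next sphere. -/
theorem mul_card_sphere (hL : IsLayer K ρ (n + 1)) (hK : IsRegularDisc K t)
    (hρ : IsRadius K v ρ) (hint : ∀ x, ρ x ≤ n → IsInterior K x) :
    t * #{x | ρ x = n} = ∑ x with ρ x = n, deg (ball K ρ n) x +
      (2 * #(sphereEdges K ρ n) + #(sphereEdges K ρ (n + 1))) := by
  rw [← (sum_card_shell hL hK hρ hint).2.1, sum_deg_sphere, ← sum_union disjoint_ball_shell,
    ball_union_shell, ← sum_deg_sphere, sum_const_nat (m := t), mul_comm]
  intro x hx
  have hx : ρ x = n := (mem_filter.1 hx).2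
  rw [← hK.deg_eq_of_interior (hint x hx.le)]
  exact deg_eq_of_forall ball_subset fun s hs hxs =>
    hρ.mem_ball_of_mem (by omega : ρ x < n + 1) hs hxs

theorem card_sphere (hK : IsRegularDisc K t) (hρ : IsRadius K v ρ) (hn : 1 ≤ n)
    (hint : ∀ x, ρ x ≤ n → IsInterior K x) : #{x | ρ x = n} = #(sphereEdges K ρ n) := by
  have h := sum_card_siblings K ρ n
  rw [sum_const_nat (m := 2)] at h
  · omega
  · intro x hx
    have hx : ρ x = n := (mem_filter.1 hx).2
    exact (isLayer hK hρ hn fun x hx => hint x hx.le).card_siblings hK hρ (hint x hx.le) hx hn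

/-- Counting triangles at the vertices of the sphere of radius `n + 1` gives `t Sₙ₊₁ = (Sₙ + 2 Sₙ₊₁)
+ (2 Sₙ₊₁ + Sₙ₊₂)`, the recurrence with `q + 2 = t - 4`. Two consecutive lengths are carried because
it has order two. Interiority is needed only up to radius `n`. -/
theorem card_sphereEdges_succ_eq (hK : IsRegularDisc K t) (hρ : IsRadius K v ρ)
    (hint : ∀ x, ρ x ≤ n → IsInterior K x) :
    #(sphereEdges K ρ n) = t * (lucasPair (t - 6) n).1 ∧
    #(sphereEdges K ρ (n + 1)) = t * (lucasPair (t - 6) (n + 1)).1 ∧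
    #(ball K ρ (n + 1)) = t * lucasArea (t - 6) (n + 1) := by
  have hL := isLayer hK hρ (Nat.le_add_left 1 n) fun x hx => hint x (by omega)
  have hmul := mul_card_sphere hL hK hρ hint
  have hball := card_ball_succ hL hK hρ hint
  induction n with
  | zero =>
    have h0 := card_sphereEdges_zero hρ
    have h1 : #{x | ρ x = 0} = 1 := card_eq_one.2 ⟨v, by ext x; simp [hρ.eq_zero_iff]⟩
    rw [h1, h0, ball_zero hK hρ] at hmul
    rw [h0, ball_zero hK hρ] at hball
    simp only [deg, filter_empty, card_empty, sum_const_zero] at hmul hball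
    simp only [lucasPair, lucasArea, h0]
    omega
  | succ n ih =>
    have hint' : ∀ x, ρ x ≤ n → IsInterior K x := fun x hx => hint x (by omega)
    have hL' := isLayer hK hρ (Nat.le_add_left 1 n) fun x hx => hint x (by omega)
    obtain ⟨i1, i2, i3⟩ := ih hint' hL' (mul_card_sphere hL' hK hρ hint')
      (card_ball_succ hL' hK hρ hint')
    rw [card_sphere hK hρ (Nat.le_add_left 1 n) hint, sum_deg_ball_succ hL' hK hρ hint'] at hmul
    have hrec := lucasPair_recurrence (t - 6) n
    have ht := hK.le_degree
    have key : #(sphereEdges K ρ (n + 1 + 1)) = t * (lucasPair (t - 6) (n + 1 + 1)).1 := by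
      obtain ⟨q, rfl⟩ := Nat.exists_eq_add_of_le (show 6 ≤ t by omega)
      rw [Nat.add_sub_cancel_left] at *
      rw [i1, i2] at hmul
      zify at hmul hrec ⊢
      linear_combination -hmul - (6 + (q : ℤ)) * hrec
    refine ⟨i2, key, ?_⟩
    rw [hball, key, i2, i3, lucasArea_succ _ (n + 1)]
    ring

end TriangleSet

/-! ### From simplicial discs to sets of triangles -/

namespace AbstractSimplicialComplex

open scoped Classical
open TriangleSet

variable {W : Type*} {D : AbstractSimplicialComplex W}

/-- The chain modulo two of the edges of a walk. -/
noncomputable def walkChain (D : AbstractSimplicialComplex W) :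
    ∀ {u v : W}, D.skeleton.Walk u v → (Sym2 W →₀ ZMod 2)
  | _, _, .nil => 0
  | _, _, .cons (u := u) (v := w) _ p => Finsupp.single s(u, w) 1 + walkChain D p

theorem walkChain_append {u v w : W} (p : D.skeleton.Walk u v) (q : D.skeleton.Walk v w) :
    D.walkChain (p.append q) = D.walkChain p + D.walkChain q := by
  induction p with
  | nil => simp [walkChain]
  | cons h p ih => simp [walkChain, ih, add_assoc]

theorem walkChain_reverse {u v : W} (p : D.skeleton.Walk u v) :
    D.walkChain p.reverse = D.walkChain p := by
  induction p with
  | nil => simp [walkChain]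
  | @cons a b c h p ih =>
    rw [SimpleGraph.Walk.reverse_cons, walkChain_append, ih, walkChain, walkChain, walkChain,
      add_zero, add_comm, Sym2.eq_swap]

/-- The chains that bound triangles of `D`. -/
noncomputable def boundaries (D : AbstractSimplicialComplex W) :
    Submodule (ZMod 2) (Sym2 W →₀ ZMod 2) :=
  (Finsupp.supported (ZMod 2) (ZMod 2) D.triangles).map (bdTwo W)

theorem subset_mem {s r : Finset W} (hs : s ∈ D) (hr : r ⊆ s) (hne : r.Nonempty) : r ∈ D :=
  (D.isRelLowerSet_faces hs).2 hr hne

theorem mem_triangles_of_mem {s : Finset W} {x y z : W} (hs : s ∈ D) (hx : x ∈ s) (hy : y ∈ s)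
    (hz : z ∈ s) (hxy : x ≠ y) (hxz : x ≠ z) (hyz : y ≠ z) : {x, y, z} ∈ D.triangles := by
  refine ⟨subset_mem hs ?_ ⟨x, by simp⟩, Finset.card_eq_three.2 ⟨x, y, z, hxy, hxz, hyz, rfl⟩⟩
  intro w
  simp only [Finset.mem_insert, Finset.mem_singleton]
  rintro (rfl | rfl | rfl) <;> assumption

/-- Homotopy implies homology: a backtracking cancels modulo two, and a triangle move changes the
chain by the boundary of that triangle. -/
theorem EdgeHomotopic.walkChain_add_mem {u v : W} {p q : D.skeleton.Walk u v}
    (h : D.EdgeHomotopic p q) : D.walkChain p + D.walkChain q ∈ D.boundaries := by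
  induction h with
  | refl p => rw [chain_add_self]; exact zero_mem _
  | symm _ ih => rwa [add_comm]
  | @trans u v p q r _ _ ih ih' =>
    have h := chain_add_self (D.walkChain q)
    have : D.walkChain p + D.walkChain r =
        (D.walkChain p + D.walkChain q) + (D.walkChain q + D.walkChain r) := by
      rw [add_assoc, ← add_assoc (D.walkChain q), h, zero_add]
    rw [this]
    exact add_mem ih ih'
  | @cons u v w h p q _ ih =>
    simp only [walkChain]
    rw [add_add_add_comm, chain_add_self, zero_add]
    exact ih
  | @backtrack u v w h h' p =>
    simp only [walkChain]
    rw [Sym2.eq_swap (a := v) (b := u), ← add_assoc, chain_add_self, zero_add, chain_add_self]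
    exact zero_mem _
  | @triangle u v w x huv hvw huw hface p =>
    obtain ⟨s, hs, hu, hv, hw⟩ := hface
    simp only [walkChain]
    refine ⟨Finsupp.single {u, v, w} 1, Finsupp.single_mem_supported _ _
      (mem_triangles_of_mem hs hu hv hw huv.1 huw.1 hvw.1), ?_⟩
    rw [bdTwo_single huv.1 huw.1 hvw.1]
    have := chain_add_self (D.walkChain p)
    calc _ = Finsupp.single s(u, v) 1 + Finsupp.single s(v, w) 1 + Finsupp.single s(u, w) 1 +
          (D.walkChain p + D.walkChain p) := by rw [this]; abel
      _ = _ := by abel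

/-- In a simply connected complex every cycle bounds. -/
theorem IsSimplyConnected.mem_boundaries (hD : D.IsSimplyConnected) {c : Sym2 W →₀ ZMod 2}
    (hc : c ∈ Finsupp.supported (ZMod 2) (ZMod 2) D.skeleton.edgeSet) (hc0 : bdOne W c = 0) :
    c ∈ D.boundaries := by
  obtain ⟨v⟩ := hD.1.nonempty
  -- A cone with apex `v`: adding to an edge the chosen walks to its endpoints gives a closed walk,
  -- whose chain bounds by simple connectedness. For a cycle the added walks cancel in total.
  let w : ∀ x, D.skeleton.Walk v x := fun x => (hD.1.preconnected v x).some
  let h : (W →₀ ZMod 2) →ₗ[ZMod 2] (Sym2 W →₀ ZMod 2) :=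
    Finsupp.linearCombination (ZMod 2) fun x => D.walkChain (w x)
  have key : Finsupp.supported (ZMod 2) (ZMod 2) D.skeleton.edgeSet ≤
      D.boundaries.comap (LinearMap.id + h ∘ₗ bdOne W) := by
    rw [Finsupp.supported_eq_span_single, Submodule.span_le]
    rintro _ ⟨e, he, rfl⟩
    induction e with | _ x y =>
    have he : D.skeleton.Adj x y := he
    simp only [SetLike.mem_coe, Submodule.mem_comap, LinearMap.add_apply, LinearMap.id_apply,
      LinearMap.comp_apply, bdOne_single, map_add, h, Finsupp.linearCombination_single, one_smul]
    have hloop := (hD.2 v ((w x).append (.cons he (w y).reverse))).walkChain_add_mem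
    rw [walkChain_append, walkChain, walkChain, walkChain_reverse, add_zero] at hloop
    rwa [add_left_comm]
  have := key hc
  simpa [hc0] using this

section Disc

variable [Fintype W]

/-- The triangles of a finite complex, as a finite set. -/
noncomputable def triangleFinset (D : AbstractSimplicialComplex W) : Finset (Finset W) :=
  (Set.toFinite D.triangles).toFinset

theorem mem_triangleFinset {s : Finset W} : s ∈ D.triangleFinset ↔ s ∈ D ∧ s.card = 3 := by
  rw [triangleFinset, Set.Finite.mem_toFinset]; rfl

theorem ncard_trianglesOn (x y : W) :
    (D.trianglesOn s(x, y)).ncard = codeg D.triangleFinset x y := by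
  rw [codeg, ← Set.ncard_coe_finset]
  congr 1
  ext s
  simp [trianglesOn, mem_triangleFinset, triangles]

theorem IsDisc.mem_nbrs_iff (hD : D.IsDisc) {x y : W} :
    y ∈ nbrs D.triangleFinset x ↔ D.skeleton.Adj x y := by
  rw [mem_nbrs]
  constructor
  · rintro ⟨h, s, hs, hx, hy⟩
    exact ⟨h.symm, s, (mem_triangleFinset.1 hs).1, hx, hy⟩
  · intro h
    refine ⟨h.1.symm, codeg_pos.1 ?_⟩
    have := hD.edge s(x, y) h
    rw [ncard_trianglesOn] at this
    omega

theorem IsDisc.codeg_eq_two (hD : D.IsDisc) {x y : W} (hx : x ∈ D.interiorVertices)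
    (h : D.skeleton.Adj x y) : codeg D.triangleFinset x y = 2 := by
  have h1 := hD.edge s(x, y) h
  have h2 : (D.trianglesOn s(x, y)).ncard ≠ 1 := fun h2 => hx ⟨s(x, y), ⟨h, h2⟩, by simp⟩
  rw [ncard_trianglesOn] at h1 h2
  omega

theorem IsDisc.isInterior (hD : D.IsDisc) {x : W} (hx : x ∈ D.interiorVertices) :
    IsInterior D.triangleFinset x :=
  fun _ hy => hD.codeg_eq_two hx (hD.mem_nbrs_iff.1 hy)

/-- Simple connectedness enters as connectedness and vanishing first homology; uniformity enters
through the interior degree. -/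
theorem IsDisc.isRegularDisc (hD : D.IsDisc) {t : ℕ} (ht : 7 ≤ t)
    (hdeg : ∀ x ∈ D.interiorVertices, (D.skeleton.neighborSet x).ncard = t) :
    IsRegularDisc D.triangleFinset t where
  card_eq s hs := (mem_triangleFinset.1 hs).2
  codeg_le x y hxy := by
    by_cases h : D.skeleton.Adj x y
    · have := hD.edge s(x, y) h
      rw [ncard_trianglesOn] at this
      omega
    · by_contra! h2
      exact h (hD.mem_nbrs_iff.1 (mem_nbrs.2 ⟨hxy.symm, codeg_pos.1 (by omega)⟩))
  link x P := by
    rintro ⟨y, hy, hPy⟩ hP z hz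
    have hreach := (hD.link x).preconnected ⟨y, hD.mem_nbrs_iff.1 hy⟩ ⟨z, hD.mem_nbrs_iff.1 hz⟩
    have : ∀ a b : {w : W // D.skeleton.Adj x w}, (D.linkGraph x).Walk a b → P a → P b := by
      intro a b p
      induction p with
      | nil => exact id
      | @cons a b c h p ih =>
        intro ha
        obtain ⟨hab, s, hs, hxs, has, hbs⟩ := h
        exact ih (hP a b (mem_triangleFinset.2 (mem_triangles_of_mem hs hxs has hbs a.2.1 b.2.1
          fun h => hab (Subtype.ext h))) ha)
    exact hreach.elim fun p => this _ _ p hPy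
  connected P := by
    rintro ⟨y, hPy⟩ hP z
    have : ∀ a b : W, D.skeleton.Walk a b → P a → P b := by
      intro a b p
      induction p with
      | nil => exact id
      | @cons a b c h p ih => exact fun ha => ih (hP a b (hD.mem_nbrs_iff.2 h) ha)
    exact (hD.simplyConnected.1.preconnected y z).elim fun p => this _ _ p hPy
  boundary := by
    obtain ⟨e, he, h⟩ := hD.boundary_nonempty
    induction e with | _ x y =>
    rw [ncard_trianglesOn] at h
    exact ⟨x, y, he.1, h⟩
  cycle c hc hc0 := by
    obtain ⟨f, hf, hfc⟩ := hD.simplyConnected.mem_boundaries (c := c) (Finsupp.supported_mono (by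
      intro e he
      induction e with | _ x y =>
      exact hD.mem_nbrs_iff.1 (mk_mem_edges_iff_nbrs.1 (Finset.mem_coe.1 he))) hc) hc0
    refine ⟨f, Finsupp.supported_mono ?_ hf, hfc⟩
    intro s hs
    exact Finset.mem_coe.2 (mem_triangleFinset.2 hs)
  card_nbrs x hx := by
    rw [← hdeg x, ← Set.ncard_coe_finset]
    · congr 1
      ext y
      simp [hD.mem_nbrs_iff]
    · rintro ⟨e, ⟨he, h⟩, hxe⟩
      obtain ⟨y, rfl⟩ := hxe
      rw [ncard_trianglesOn, hx y (hD.mem_nbrs_iff.2 he)] at h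
      omega
  le_degree := ht

theorem IsDisc.isRadius (hD : D.IsDisc) (v : W) :
    IsRadius D.triangleFinset v (D.skeleton.dist v) where
  eq_zero_iff x := by
    rw [hD.simplyConnected.1.dist_eq_zero_iff, eq_comm]
  le_succ x y hy := by
    have h := hD.mem_nbrs_iff.1 hy
    have := hD.simplyConnected.1.dist_triangle (u := v) (v := x) (w := y)
    rwa [SimpleGraph.dist_eq_one_iff_adj.2 h] at this
  exists_parent x hx := by
    obtain ⟨p, hp⟩ := hD.simplyConnected.1.exists_walk_length_eq_dist x v
    cases p with
    | nil => exact absurd rfl hx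
    | @cons _ y _ h p =>
      refine ⟨y, hD.mem_nbrs_iff.2 h, ?_⟩
      have h1 := SimpleGraph.dist_le p
      have h2 := hD.simplyConnected.1.dist_triangle (u := v) (v := y) (w := x)
      rw [SimpleGraph.dist_eq_one_iff_adj.2 h.symm] at h2
      rw [SimpleGraph.Walk.length_cons, SimpleGraph.dist_comm] at hp
      rw [SimpleGraph.dist_comm] at h1
      omega

theorem IsDisc.sphereLength_eq (hD : D.IsDisc) (v : W) (n : ℕ) :
    D.sphereLength v n = (sphereEdges D.triangleFinset (D.skeleton.dist v) n).card := by
  rw [sphereLength, ← Set.ncard_coe_finset]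
  congr 1
  ext e
  induction e with | _ x y =>
  simp [sphere, sphereEdges, mk_mem_edges_iff_nbrs, hD.mem_nbrs_iff]

theorem sphereArea_eq (v : W) (n : ℕ) :
    D.sphereArea v n = (ball D.triangleFinset (D.skeleton.dist v) n).card := by
  rw [sphereArea, ← Set.ncard_coe_finset]
  congr 1
  ext s
  simp [ball, mem_triangleFinset, triangles]

/-- The length and the area of a full sphere in a disc whose interior vertices all have degree
`t ≥ 7`. -/
theorem IsDisc.sphereLength_and_sphereArea (hD : D.IsDisc) {t : ℕ} (ht : 7 ≤ t)
    (hdeg : ∀ x ∈ D.interiorVertices, (D.skeleton.neighborSet x).ncard = t) {v : W} {n : ℕ}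
    (hfull : D.IsFullSphere v n) :
    D.sphereLength v n = t * (lucasPair (t - 6) n).1 ∧
      D.sphereArea v n = t * lucasArea (t - 6) n := by
  have hK := hD.isRegularDisc ht hdeg
  have hρ := hD.isRadius v
  rw [hD.sphereLength_eq, sphereArea_eq]
  cases n with
  | zero =>
    rw [card_sphereEdges_zero hρ, ball_zero hK hρ]
    simp [lucasPair, lucasArea]
  | succ n =>
    obtain ⟨-, h1, h2⟩ := card_sphereEdges_succ_eq hK hρ (n := n) fun x hx =>
      hD.isInterior (hfull x (by omega))
    exact ⟨h1, h2⟩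

end Disc

end AbstractSimplicialComplex

/-! ### The main theorem -/

theorem theorem3p4 (t : ℕ) (ht : 7 ≤ t) :
    ∃ S A : ℕ → ℕ,
      (∀ (V : Type*) (X : AbstractSimplicialComplex V), X.IsUniform t →
        ∀ (x : V) (γ : X.skeleton.Walk x x), γ.IsCycle →
          ∀ (W : Type) [Finite W] (D : AbstractSimplicialComplex W) (f : W → V),
            X.IsMinimalFillingDiagram γ D f →
              ∀ v ∈ D.interiorVertices, ∀ n : ℕ, D.IsFullSphere v n →
                D.sphereLength v n = S n ∧ D.sphereArea v n = A n) ∧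
      StrictMonoOn (fun n : ℕ => (A n : ℝ) / (S n : ℝ)) (Set.Ici 1) ∧
      Tendsto (fun n : ℕ => (A n : ℝ) / (S n : ℝ)) atTop
        (𝓝 (Real.sqrt (((t : ℝ) - 2) / ((t : ℝ) - 6)))) ∧
      (∀ n : ℕ, 1 ≤ n →
        (A n : ℝ) < Real.sqrt (((t : ℝ) - 2) / ((t : ℝ) - 6)) * (S n : ℝ)) ∧
      (t = 7 → ∀ n : ℕ, 1 ≤ n → (A n : ℝ) < Real.sqrt 5 * (S n : ℝ)) := by
  have hq : 0 < t - 6 := by omega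
  have ht0 : (0 : ℝ) < t := by exact_mod_cast (by omega : 0 < t)
  -- With `q = t - 6` one has `q + 4 = t - 2`; the natural subtraction is exact because `t ≥ 7`.
  have hlim : ((t : ℝ) - 2) / ((t : ℝ) - 6) = (((t - 6 : ℕ) : ℝ) + 4) / ((t - 6 : ℕ) : ℝ) := by
    rw [Nat.cast_sub (by omega)]; push_cast; ring
  have hratio : ∀ n : ℕ, ((t * lucasArea (t - 6) n : ℕ) : ℝ) / ((t * (lucasPair (t - 6) n).1 : ℕ) : ℝ)
      = (lucasArea (t - 6) n : ℝ) / (lucasPair (t - 6) n).1 := fun n => by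
    push_cast
    exact mul_div_mul_left _ _ ht0.ne'
  have hlt : ∀ n : ℕ, 1 ≤ n → ((t * lucasArea (t - 6) n : ℕ) : ℝ) <
      Real.sqrt (((t : ℝ) - 2) / ((t : ℝ) - 6)) * ((t * (lucasPair (t - 6) n).1 : ℕ) : ℝ) := by
    intro n hn
    rw [hlim]
    push_cast
    rw [mul_left_comm]
    exact mul_lt_mul_of_pos_left (lucasArea_lt hq hn) ht0
  refine ⟨fun n => t * (lucasPair (t - 6) n).1, fun n => t * lucasArea (t - 6) n, ?_, ?_, ?_, hlt, ?_⟩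
  · intro V X hX x γ hγ W _ D f hf v _ n hfull
    have := Fintype.ofFinite W
    exact hf.1.disc.sphereLength_and_sphereArea ht (hX.2.2 x γ hγ W D f hf) hfull
  · simp only [hratio]
    exact strictMonoOn_lucasArea_div hq
  · simp only [hratio, hlim]
    exact tendsto_lucasArea_div hq
  · rintro rfl n hn
    have := hlt n hn
    norm_num at this ⊢
    exact this
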